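/- Let $k\ge 3$ be an integer and let $q\ge 2$ be an even integer. Let $L(k,q)$ be the rectangular hexagon lattice in the plane: its vertices are the points $v_{i,j}=(i,j)$ with integers $0\le i\le k$, $0\le j\le q$, and its edges are the horizontal segments $v_{i,j}v_{i+1,j}$ ($0\le i\le k-1$, $0\le j\le q$) and the vertical segments $v_{i,j}v_{i,j+1}$ ($0\le i\le k$, $0\le j\le q-1$, $i\equiv j \pmod 2$). Let $K_o(k,q)$ be the graph obtained from $L(k,q)$ by first identifying $v_{i,0}$ with $v_{i,q}$ for all $i$, and then identifying $v_{0,j}$ with $v_{k,q-1-j}$ for all $j$ if $k$ is even, and $v_{0,j}$ with $v_{k,q-2-j}$ for all $j$ if $k$ is odd (second indices being read modulo $q$). It is embedded in the closed surface whose faces are the hexagons of the lattice, that is, the discs bounded by the images of the cycles through $(i,j),(i+1,j),(i+2,j),(i+2,j+1),(i+1,j+1),(i,j+1)$ with $0\le i<k$, $0\le j<q$, $i\equiv j\pmod 2$, where a point $(k+a,j)$ with $a\ge 0$ stands for $v_{a,q-1-j}$ ($k$ even) or $v_{a,q-2-j}$ ($k$ odd). A cycle of a graph embedded in a surface is called one-sided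 if its tubular neighbourhood is a Möbius strip (that is, if the cycle does not disconnect its tubular neighbourhood), and separating if its complement in the surface is disconnected. An embedding of a graph in the Klein bottle is called cross-cap-odd if every non-separating cycle of the graph has odd length if and only if it is one-sided. Then the surface above is the Klein bottle, and the embedding of $K_o(k,q)$ in it is cross-cap-odd: every cycle of $K_o(k,q)$ that does not separate the Klein bottle has odd length if and only if it is one-sided. -/

import Mathlib

/-! ### Graphs embedded in closed surfaces, given by their facial cycles

A strong 2-cell embedding of a graph `G` in a closed surface is the same thing as a family of
cycles of `G`, one for each face, such that gluing a disc to `G` along each of these cycles yields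
a surface. The family is recorded as `bd : F → Set (Sym2 V)`, where `F` is the set of faces and
`bd f` is the set of edges on the boundary of the face `f`. -/

namespace SurfaceMap

variable {V F : Type*}

/-- The closed walk `w` runs once around the boundary of the face `f`, which is a cycle. -/
def Bounds (G : SimpleGraph V) (bd : F → Set (Sym2 V)) (f : F) {v : V} (w : G.Walk v v) : Prop :=
  w.IsCycle ∧ ∀ e, e ∈ w.edges ↔ e ∈ bd f

/-- The vertex `v` lies on the boundary of the face `f`. -/
def Touches (bd : F → Set (Sym2 V)) (v : V) (f : F) : Prop :=
  ∃ e ∈ bd f, v ∈ e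

/-- The link of the vertex `v`: its vertices are the edges of `G` at `v`, and two of them are
adjacent if they form a corner of a face at `v`. -/
def link (G : SimpleGraph V) (bd : F → Set (Sym2 V)) (v : V) :
    SimpleGraph {e : Sym2 V // e ∈ G.edgeSet ∧ v ∈ e} :=
  SimpleGraph.fromRel fun e e' => ∃ f, e.1 ∈ bd f ∧ e'.1 ∈ bd f

/-- The discs glued to the connected finite graph `G` along the sets `bd f` form a closed connected
surface in which `G` is strongly embedded: every face is bounded by a cycle, every edge lies
on exactly two faces, and the faces around a vertex form one cyclic sequence (as every edge lies
on two faces, each link is a disjoint union of cycles, so that this says that it is connected). -/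
structure IsStrongEmbedding (G : SimpleGraph V) (bd : F → Set (Sym2 V)) : Prop where
  finite_vert : Finite V
  finite_face : Finite F
  connected : G.Connected
  facial : ∀ f, ∃ (v : V) (w : G.Walk v v), Bounds G bd f w
  two_faces : ∀ e ∈ G.edgeSet, {f | e ∈ bd f}.ncard = 2
  link_connected : ∀ v, (link G bd v).Connected

/-- The surface is orientable: the facial cycles can be directed in such a way that no edge is
traversed in the same direction by two different faces. -/
def Orientable (G : SimpleGraph V) (bd : F → Set (Sym2 V)) : Prop :=
  ∃ (b : F → V) (w : ∀ f, G.Walk (b f) (b f)), (∀ f, Bounds G bd f (w f)) ∧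
    ∀ f f', f ≠ f' → ∀ d ∈ (w f).darts, d ∉ (w f').darts

/-- The Euler characteristic of the surface. -/
noncomputable def eulerChar (G : SimpleGraph V) (F : Type*) : ℤ :=
  (Nat.card V : ℤ) - Nat.card G.edgeSet + Nat.card F

/-- `G` is strongly embedded in the Klein bottle, the closed connected non-orientable surface of
Euler characteristic `0`. -/
structure IsKleinBottleEmbedding (G : SimpleGraph V) (bd : F → Set (Sym2 V)) : Prop where
  strong : IsStrongEmbedding G bd
  nonorientable : ¬ Orientable G bd
  euler : eulerChar G F = 0

/-- The complement in the surface of the edges in `C` and their ends, as a graph on the faces: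
one passes from a face to another one across an edge that is not in `C`. -/
def complementGraph (bd : F → Set (Sym2 V)) (C : Set (Sym2 V)) : SimpleGraph F :=
  SimpleGraph.fromRel fun f f' => ∃ e, e ∉ C ∧ e ∈ bd f ∧ e ∈ bd f'

/-- The cycle with edge set `C` separates the surface: its complement is not connected. -/
def Separates (bd : F → Set (Sym2 V)) (C : Set (Sym2 V)) : Prop :=
  ¬ (complementGraph bd C).Connected

/-- What remains of a tubular neighbourhood of the cycle with edge set `C` when the cycle itself
is removed. It consists of the corners `(v, f)`, where `v` is a vertex of the cycle and `f` is
a face at `v`. Two corners at the same vertex `v` are glued along an edge at `v` that does not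
belong to the cycle; two corners of the same face `f` at the two ends of an edge of the cycle on
the boundary of `f` are joined along the `f`-side of this edge. -/
def sideGraph (bd : F → Set (Sym2 V)) (C : Set (Sym2 V)) :
    SimpleGraph {c : V × F // (∃ e ∈ C, c.1 ∈ e) ∧ Touches bd c.1 c.2} :=
  SimpleGraph.fromRel fun c c' =>
    (c.1.1 = c'.1.1 ∧ ∃ e, e ∉ C ∧ c.1.1 ∈ e ∧ e ∈ bd c.1.2 ∧ e ∈ bd c'.1.2) ∨
    (c.1.2 = c'.1.2 ∧ s(c.1.1, c'.1.1) ∈ C ∧ s(c.1.1, c'.1.1) ∈ bd c.1.2)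

/-- The cycle with edge set `C` is one-sided. Its tubular neighbourhood is a bundle of intervals
over a circle, hence an annulus, which the central circle cuts into two parts, or a Möbius strip,
which the central circle does not disconnect; the cycle is one-sided in the second case. -/
def OneSided (bd : F → Set (Sym2 V)) (C : Set (Sym2 V)) : Prop :=
  (sideGraph bd C).Connected

/-- `G` is embedded in the Klein bottle, and a cycle of `G` that does not separate the surface is
odd if and only if it is one-sided. -/
def IsCrossCapOdd (G : SimpleGraph V) (bd : F → Set (Sym2 V)) : Prop :=
  IsKleinBottleEmbedding G bd ∧
    ∀ (v : V) (w : G.Walk v v), w.IsCycle → ¬ Separates bd {e | e ∈ w.edges} →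
      (Odd w.length ↔ OneSided bd {e | e ∈ w.edges})

end SurfaceMap

/-! ### The polyhex `K_o(k, q)` -/

namespace Ko

/-- The edges of the rectangular hexagon lattice `L(k, q)`, whose vertices are the points `(i, j)`
with `0 ≤ i ≤ k` and `0 ≤ j ≤ q`, each edge directed to the right or upwards. -/
def LatticeEdge (k q : ℕ) (p r : ℕ × ℕ) : Prop :=
  (p.1 + 1 ≤ k ∧ p.2 ≤ q ∧ r = (p.1 + 1, p.2)) ∨
  (p.1 ≤ k ∧ p.2 + 1 ≤ q ∧ p.1 % 2 = p.2 % 2 ∧ r = (p.1, p.2 + 1))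

/-- The vertices of `K_o(k, q)`: each of them is `v_{i,j}` for exactly one `i` with `0 ≤ i < k`
and one `j` modulo `q`. -/
abbrev Vert (k q : ℕ) : Type := ZMod k × ZMod q

/-- The vertex of `K_o(k, q)` that the point `(i, j)` becomes. As `v_{i,0} = v_{i,q}`, the second
coordinate counts modulo `q`; the point `(k, j)` becomes `v_{0,q-1-j}` if `k` is even and
`v_{0,q-2-j}` if `k` is odd. For `k < i < 2 * k` this continues the lattice across the
line along which the two ends are glued: `(k + a, j)` is identified with `(a, q-1-j)` or
`(a, q-2-j)`. -/
def pt (k q : ℕ) (p : ℕ × ℕ) : Vert k q :=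
  if p.1 < k then ((p.1 : ZMod k), (p.2 : ZMod q))
  else if Even k then (((p.1 - k : ℕ) : ZMod k), (q : ZMod q) - 1 - (p.2 : ZMod q))
  else (((p.1 - k : ℕ) : ZMod k), (q : ZMod q) - 2 - (p.2 : ZMod q))

/-- The graph `K_o(k, q)`: the lattice `L(k, q)` after the identifications. -/
def graph (k q : ℕ) : SimpleGraph (Vert k q) :=
  SimpleGraph.fromRel fun u v => ∃ p r, LatticeEdge k q p r ∧ pt k q p = u ∧ pt k q r = v

/-- The hexagonal faces, indexed by their lower left corners `(i, j)`, where `i ≡ j` modulo `2`. -/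
abbrev Face (k q : ℕ) : Type := {p : ℕ × ℕ // p.1 < k ∧ p.2 < q ∧ p.1 % 2 = p.2 % 2}

/-- The boundary of the hexagon with corners `(i, j)`, `(i + 1, j)`, `(i + 2, j)`,
`(i + 2, j + 1)`, `(i + 1, j + 1)`, `(i, j + 1)`. -/
def faceBd (k q : ℕ) (f : Face k q) : Set (Sym2 (Vert k q)) :=
  let x : ℕ → ℕ → Vert k q := fun a b => pt k q (f.1.1 + a, f.1.2 + b)
  {s(x 0 0, x 1 0), s(x 1 0, x 2 0), s(x 2 0, x 2 1),
    s(x 2 1, x 1 1), s(x 1 1, x 0 1), s(x 0 1, x 0 0)}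

end Ko

/-! The whole argument rests on one structure: in every hexagon mark alternate edges, in such a way
that each edge is marked in exactly one of its two faces. In the plane lattice one numbers the edges
of each hexagon from its lower left corner and marks those with an even number. The gluing maps
preserve this choice, since a reflection in a horizontal line turns edge `t` into edge `4 - t`.

At a vertex, turning within each face from its marked edge to its unmarked one gives a rotation of
the three edges, that is, a local orientation of the surface. Along an edge `vu` on a face `f`, the
mark of `vu` in `f` is the same at both ends, but seen from `v` and from `u` the face lies to
opposite hands; so the local orientations at adjacent vertices disagree. Carrying an orientation
around a cycle of length `n` therefore reverses it `n` times, and a cycle is one-sided exactly if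
`n` is odd (`IsAlternating.odd_length_iff_oneSided`).

The same comparison yields non-orientability: a global orientation would agree with the local one on
one class of a proper 2-colouring (`IsAlternating.exists_two_coloring`), while the graph contains a
closed walk of odd length (`not_two_colorable`). The Euler characteristic vanishes because the graph
is cubic on `kq` vertices and has `kq/2` faces.

To verify the local structure, the graph and its faces are lifted to `ℤ × ℤ`, on which a translation
and a glide reflection act. -/

namespace SurfaceMap

/-! ### Alternating maps: local structure at a vertex -/

variable {V F : Type*}

/-- At the vertex `v`, which has the three neighbours `nb l` and the three faces `fc m`, the face
`fc m` is the one that avoids the edge to `nb m`; of its two edges at `v` exactly one belongs to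
`pos (fc m)`, and of the two faces at an edge exactly one has this edge in `pos`. -/
structure AlternatingAt (G : SimpleGraph V) (bd pos : F → Set (Sym2 V)) (v : V)
    (nb : Fin 3 → V) (fc : Fin 3 → F) : Prop where
  nb_inj : Function.Injective nb
  adj_iff : ∀ u, G.Adj v u ↔ ∃ l, u = nb l
  touch : ∀ f, Touches bd v f → ∃ m, f = fc m
  mem_iff : ∀ l m, s(v, nb l) ∈ bd (fc m) ↔ l ≠ m
  pos_iff : ∀ l m, s(v, nb l) ∈ pos (fc m) ↔ l = m + 1

/-- A cubic map whose facial cycles have their edges alternately inside and outside `pos`, in such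
a way that every edge is inside for one of its faces and outside for the other one. -/
structure IsAlternating (G : SimpleGraph V) (bd pos : F → Set (Sym2 V)) : Prop where
  sub : ∀ f, bd f ⊆ G.edgeSet
  corner : ∀ v, ∃ nb fc, AlternatingAt G bd pos v nb fc

open Classical in
/-- The indicator of `pos` modulo `2`. -/
noncomputable def chi (pos : F → Set (Sym2 V)) (e : Sym2 V) (f : F) : ZMod 2 :=
  if e ∈ pos f then 1 else 0

namespace IsAlternating

variable {G : SimpleGraph V} {bd pos : F → Set (Sym2 V)}

theorem adj (h : IsAlternating G bd pos) {v u : V} {f : F} (hf : s(v, u) ∈ bd f) : G.Adj v u :=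
  h.sub f hf

/-- With `chi_other_edge`, this is the form in which the alternation is used: at a vertex, `chi`
flips when either the face or the edge alone is changed. -/
theorem chi_other_face (h : IsAlternating G bd pos) {v u : V} {f f' : F} (hf : s(v, u) ∈ bd f)
    (hf' : s(v, u) ∈ bd f') (hne : f ≠ f') : chi pos s(v, u) f' = chi pos s(v, u) f + 1 := by
  obtain ⟨nb, fc, H⟩ := h.corner v
  obtain ⟨l, rfl⟩ := (H.adj_iff u).1 (h.adj hf)
  obtain ⟨m, rfl⟩ := H.touch f ⟨_, hf, Sym2.mem_mk_left _ _⟩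
  obtain ⟨m', rfl⟩ := H.touch f' ⟨_, hf', Sym2.mem_mk_left _ _⟩
  have hm : m ≠ m' := fun e => hne (by rw [e])
  simp only [chi, H.pos_iff]
  rw [H.mem_iff] at hf hf'
  clear hne H
  decide +revert

theorem chi_other_edge (h : IsAlternating G bd pos) {v u u' : V} {f : F} (hu : s(v, u) ∈ bd f)
    (hu' : s(v, u') ∈ bd f) (hne : u ≠ u') : chi pos s(v, u') f = chi pos s(v, u) f + 1 := by
  obtain ⟨nb, fc, H⟩ := h.corner v
  obtain ⟨l, rfl⟩ := (H.adj_iff u).1 (h.adj hu)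
  obtain ⟨l', rfl⟩ := (H.adj_iff u').1 (h.adj hu')
  obtain ⟨m, rfl⟩ := H.touch f ⟨_, hu, Sym2.mem_mk_left _ _⟩
  have hl : l ≠ l' := fun e => hne (by rw [e])
  simp only [chi, H.pos_iff]
  rw [H.mem_iff] at hu hu'
  clear hne H
  decide +revert

theorem face_unique (h : IsAlternating G bd pos) {v u : V} {f f' : F} (hf : s(v, u) ∈ bd f)
    (hf' : s(v, u) ∈ bd f') (he : chi pos s(v, u) f = chi pos s(v, u) f') : f = f' := by
  by_contra hne
  have := h.chi_other_face hf hf' hne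
  rw [← he] at this
  simp at this

/-- Together with `face_unique`, this makes `chi` a label for the two sides of an edge. -/
theorem exists_face (h : IsAlternating G bd pos) {v u : V} (ha : G.Adj v u) (x : ZMod 2) :
    ∃ f, s(v, u) ∈ bd f ∧ chi pos s(v, u) f = x := by
  obtain ⟨nb, fc, H⟩ := h.corner v
  obtain ⟨l, rfl⟩ := (H.adj_iff u).1 ha
  have : ∃ m : Fin 3, l ≠ m ∧ (if l = m + 1 then (1 : ZMod 2) else 0) = x := by
    clear ha H
    decide +revert
  obtain ⟨m, hm, hx⟩ := this
  refine ⟨fc m, (H.mem_iff l m).2 hm, ?_⟩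
  simpa only [chi, H.pos_iff] using hx

theorem exists_common_face (h : IsAlternating G bd pos) {v a b : V} (ha : G.Adj v a)
    (hb : G.Adj v b) : ∃ f, s(v, a) ∈ bd f ∧ s(v, b) ∈ bd f := by
  obtain ⟨nb, fc, H⟩ := h.corner v
  obtain ⟨l, rfl⟩ := (H.adj_iff a).1 ha
  obtain ⟨l', rfl⟩ := (H.adj_iff b).1 hb
  have : ∃ m : Fin 3, l ≠ m ∧ l' ≠ m := by
    clear ha hb H
    decide +revert
  obtain ⟨m, h1, h2⟩ := this
  exact ⟨fc m, (H.mem_iff _ m).2 h1, (H.mem_iff _ m).2 h2⟩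

theorem exists_third_edge (h : IsAlternating G bd pos) {v a b : V} (ha : G.Adj v a)
    (hb : G.Adj v b) (hab : a ≠ b) : ∃ c, G.Adj v c ∧ c ≠ a ∧ c ≠ b ∧
      (∀ u, G.Adj v u → u = a ∨ u = b ∨ u = c) ∧
      ∀ f, Touches bd v f → (s(v, a) ∈ bd f ∨ s(v, b) ∈ bd f) ∧
        (s(v, a) ∈ bd f ∨ s(v, c) ∈ bd f) ∧ (s(v, b) ∈ bd f ∨ s(v, c) ∈ bd f) := by
  obtain ⟨nb, fc, H⟩ := h.corner v
  obtain ⟨l, rfl⟩ := (H.adj_iff a).1 ha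
  obtain ⟨l', rfl⟩ := (H.adj_iff b).1 hb
  have hl : l ≠ l' := fun e => hab (by rw [e])
  have : ∃ o : Fin 3, o ≠ l ∧ o ≠ l' ∧ (∀ x, x = l ∨ x = l' ∨ x = o) ∧ ∀ m : Fin 3,
      (l ≠ m ∨ l' ≠ m) ∧ (l ≠ m ∨ o ≠ m) ∧ (l' ≠ m ∨ o ≠ m) := by
    clear ha hb H hab
    decide +revert
  obtain ⟨o, h1, h2, h3, h4⟩ := this
  refine ⟨nb o, (H.adj_iff _).2 ⟨o, rfl⟩, H.nb_inj.ne h1, H.nb_inj.ne h2, ?_, ?_⟩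
  · intro u hu
    obtain ⟨x, rfl⟩ := (H.adj_iff u).1 hu
    rcases h3 x with rfl | rfl | rfl <;> simp
  · intro f hf
    obtain ⟨m, rfl⟩ := H.touch f hf
    simpa only [H.mem_iff] using h4 m

/-- Three edges at a vertex do not lie on a common face. -/
theorem not_three_edges (h : IsAlternating G bd pos) {v a b c : V} {f : F} (hab : a ≠ b)
    (hac : a ≠ c) (hbc : b ≠ c) (ha : s(v, a) ∈ bd f) (hb : s(v, b) ∈ bd f)
    (hc : s(v, c) ∈ bd f) : False := by
  have h1 := h.chi_other_edge ha hb hab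
  have h2 := h.chi_other_edge ha hc hac
  have h3 := h.chi_other_edge hb hc hbc
  rw [h2, h1] at h3
  simp at h3

/-- Two different faces at a vertex share only one edge there. -/
theorem not_two_common_edges (h : IsAlternating G bd pos) {v a b c : V} {f f' : F}
    (hv : G.Adj v a) (hab : a ≠ b) (hac : a ≠ c) (hbc : b ≠ c) (hf : f ≠ f')
    (hb : s(v, b) ∈ bd f) (hc : s(v, c) ∈ bd f) (hb' : s(v, b) ∈ bd f')
    (hc' : s(v, c) ∈ bd f') : False := by
  obtain ⟨g, hga, hgb⟩ := h.exists_common_face hv (h.adj hb)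
  have h1 := h.chi_other_face hb hb' hf
  by_cases hg : g = f
  · subst hg
    exact h.not_three_edges hab hac hbc hga hgb hc
  by_cases hg' : g = f'
  · subst hg'
    exact h.not_three_edges hab hac hbc hga hgb hc'
  have h2 := h.chi_other_face hgb hb hg
  have h3 := h.chi_other_face hgb hb' hg'
  rw [h2, h3] at h1
  simp at h1

theorem ncard_faces (h : IsAlternating G bd pos) (e : Sym2 V) (he : e ∈ G.edgeSet) :
    {f | e ∈ bd f}.ncard = 2 := by
  induction e with | _ v u
  obtain ⟨f, hf, hf0⟩ := h.exists_face he 0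
  obtain ⟨g, hg, hg1⟩ := h.exists_face he 1
  rw [Set.ncard_eq_two]
  refine ⟨f, g, ?_, ?_⟩
  · rintro rfl
    rw [hf0] at hg1
    simp at hg1
  · ext x
    simp only [Set.mem_ofPred_eq, Set.mem_insert_iff, Set.mem_singleton_iff]
    constructor
    · intro hx
      have : ∀ y : ZMod 2, y = 0 ∨ y = 1 := by decide
      rcases this (chi pos s(v, u) x) with h0 | h1
      · exact Or.inl (h.face_unique hx hf (h0.trans hf0.symm))
      · exact Or.inr (h.face_unique hx hg (h1.trans hg1.symm))
    · rintro (rfl | rfl) <;> assumption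

/-- Any two edges at a vertex lie on a common face, so the link is a complete graph. -/
theorem link_connected (h : IsAlternating G bd pos) (v : V) : (link G bd v).Connected := by
  obtain ⟨nb, fc, H⟩ := h.corner v
  have : Nonempty {e : Sym2 V // e ∈ G.edgeSet ∧ v ∈ e} :=
    ⟨⟨s(v, nb 0), (H.adj_iff _).2 ⟨0, rfl⟩, Sym2.mem_mk_left _ _⟩⟩
  refine SimpleGraph.Connected.mk ?_
  rintro ⟨e, he, hv⟩ ⟨e', he', hv'⟩
  by_cases hne : e = e'
  · subst hne
    rfl
  · obtain ⟨a, rfl⟩ := hv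
    obtain ⟨b, rfl⟩ := hv'
    obtain ⟨f, hf, hf'⟩ := h.exists_common_face he he'
    refine SimpleGraph.Adj.reachable ?_
    rw [link, SimpleGraph.fromRel_adj]
    exact ⟨fun hh => hne (congrArg Subtype.val hh), Or.inl ⟨f, hf, hf'⟩⟩

end IsAlternating

/-! ### Cycles indexed by `ZMod n` -/

/-- The vertices of a cycle, indexed cyclically. -/
theorem exists_cyclic_param {G : SimpleGraph V} {v : V} {w : G.Walk v v} (hw : w.IsCycle) :
    ∃ c : ZMod w.length → V, Function.Injective c ∧ (∀ t, G.Adj (c t) (c (t + 1))) ∧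
      ∀ d : G.Dart, d ∈ w.darts ↔ ∃ t, d.fst = c t ∧ d.snd = c (t + 1) := by
  have h3 := hw.three_le_length
  have : NeZero w.length := ⟨by omega⟩
  have : Fact (1 < w.length) := ⟨by omega⟩
  have hval : ∀ t : ZMod w.length, w.getVert (t + 1).val = w.getVert (t.val + 1) := by
    intro t
    have ht := ZMod.val_lt t
    rw [ZMod.val_add, ZMod.val_one]
    by_cases h : t.val + 1 = w.length
    · rw [h, Nat.mod_self, w.getVert_zero, w.getVert_length]
    · rw [Nat.mod_eq_of_lt (by omega)]
  refine ⟨fun t => w.getVert t.val, ?_, ?_, ?_⟩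
  · intro s t hst
    have hs := ZMod.val_lt s
    have ht := ZMod.val_lt t
    exact ZMod.val_injective _ (hw.getVert_injOn' (by simp; omega) (by simp; omega) hst)
  · intro t
    beta_reduce
    rw [hval]
    exact w.adj_getVert_succ (ZMod.val_lt t)
  · intro d
    rw [List.mem_iff_getElem]
    constructor
    · rintro ⟨i, hi, rfl⟩
      rw [SimpleGraph.Walk.length_darts] at hi
      refine ⟨(i : ZMod w.length), ?_⟩
      beta_reduce
      rw [hval, ZMod.val_natCast, Nat.mod_eq_of_lt hi, SimpleGraph.Walk.darts_getElem_eq_getVert]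
      exact ⟨rfl, rfl⟩
    · rintro ⟨t, h1, h2⟩
      have ht := ZMod.val_lt t
      refine ⟨t.val, by simpa using ht, ?_⟩
      rw [SimpleGraph.Walk.darts_getElem_eq_getVert]
      ext
      · exact h1.symm
      · exact ((h2.trans (hval t))).symm

theorem mem_edges_iff_cyclic {G : SimpleGraph V} {v : V} {w : G.Walk v v} {n : ℕ}
    {c : ZMod n → V} (ha : ∀ t, G.Adj (c t) (c (t + 1)))
    (hc : ∀ d : G.Dart, d ∈ w.darts ↔ ∃ t, d.fst = c t ∧ d.snd = c (t + 1)) (e : Sym2 V) :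
    e ∈ w.edges ↔ ∃ t, e = s(c t, c (t + 1)) := by
  rw [SimpleGraph.Walk.edges, List.mem_map]
  constructor
  · rintro ⟨d, hd, rfl⟩
    obtain ⟨t, h1, h2⟩ := (hc d).1 hd
    refine ⟨t, ?_⟩
    rw [← h1, ← h2]
    rfl
  · rintro ⟨t, rfl⟩
    exact ⟨⟨(c t, c (t + 1)), ha t⟩, (hc _).2 ⟨t, rfl, rfl⟩, rfl⟩

theorem mk_mem_cyclic_iff {n : ℕ} {c : ZMod n → V} (hc : Function.Injective c) (t : ZMod n)
    (u : V) : (∃ r, s(c t, u) = s(c r, c (r + 1))) ↔ u = c (t + 1) ∨ u = c (t - 1) := by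
  constructor
  · rintro ⟨r, hr⟩
    rcases Sym2.eq_iff.1 hr with ⟨h1, h2⟩ | ⟨h1, h2⟩
    · rw [hc h1]
      exact Or.inl h2
    · rw [hc h1, add_sub_cancel_right]
      exact Or.inr h2
  · rintro (rfl | rfl)
    · exact ⟨t, rfl⟩
    · exact ⟨t - 1, by rw [sub_add_cancel]; exact Sym2.eq_swap⟩

theorem cyclic_add_one_ne_sub_one {n : ℕ} (hn : 3 ≤ n) (t : ZMod n) : t + 1 ≠ t - 1 := by
  intro h
  have h2 : ((2 : ℕ) : ZMod n) = 0 := by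
    push_cast
    linear_combination h
  rw [ZMod.natCast_eq_zero_iff] at h2
  have := Nat.le_of_dvd (by norm_num) h2
  omega

end SurfaceMap

/-! ### The two sides of a cycle -/

namespace SurfaceMap

variable {V F : Type*}

open Classical in
/-- The side of the cycle `c` on which the face `f` lies at `c t`. -/
noncomputable def side (bd pos : F → Set (Sym2 V)) {n : ℕ} (c : ZMod n → V) (t : ZMod n) (f : F) :
    ZMod 2 :=
  if s(c t, c (t + 1)) ∈ bd f then chi pos s(c t, c (t + 1)) f
  else chi pos s(c t, c (t - 1)) f + 1

section Side

variable {G : SimpleGraph V} {bd pos : F → Set (Sym2 V)} {n : ℕ} {c : ZMod n → V}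

theorem side_of_next {t : ZMod n} {f : F} (hf : s(c t, c (t + 1)) ∈ bd f) :
    side bd pos c t f = chi pos s(c t, c (t + 1)) f := if_pos hf

/-- A face at `c t` contains at least one of the two cycle edges there. If it contains both, `chi`
differs on them, and the `+ 1` in the second branch of `side` makes the two descriptions agree. -/
theorem side_of_prev (h : IsAlternating G bd pos) (hn : 3 ≤ n) (hc : Function.Injective c)
    {t : ZMod n} {f : F} (hf : s(c t, c (t - 1)) ∈ bd f) :
    side bd pos c t f = chi pos s(c t, c (t - 1)) f + 1 := by
  by_cases hb : s(c t, c (t + 1)) ∈ bd f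
  · rw [side_of_next hb]
    exact h.chi_other_edge hf hb (hc.ne (cyclic_add_one_ne_sub_one hn t).symm)
  · exact if_neg hb

/-- The sides of the ends of an edge of the cycle do not agree. -/
theorem side_add_one (h : IsAlternating G bd pos) (hn : 3 ≤ n) (hc : Function.Injective c)
    {t : ZMod n} {f : F} (hf : s(c t, c (t + 1)) ∈ bd f) :
    side bd pos c (t + 1) f = side bd pos c t f + 1 := by
  rw [side_of_next hf]
  have := side_of_prev (t := t + 1) (f := f) h hn hc
  rw [add_sub_cancel_right, Sym2.eq_swap] at this
  exact this hf

theorem adj_cyclic_prev (ha : ∀ t, G.Adj (c t) (c (t + 1))) (t : ZMod n) :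
    G.Adj (c t) (c (t - 1)) := by
  have := ha (t - 1)
  rw [sub_add_cancel] at this
  exact this.symm

/-- Corners on the same side are equal or share an edge that is not in the cycle. -/
theorem eq_or_glued_of_side_eq (h : IsAlternating G bd pos) (hn : 3 ≤ n)
    (hc : Function.Injective c) (ha : ∀ t, G.Adj (c t) (c (t + 1))) {t : ZMod n} {f f' : F}
    (hf : Touches bd (c t) f) (hf' : Touches bd (c t) f')
    (hs : side bd pos c t f = side bd pos c t f') :
    f = f' ∨ ∃ u, u ≠ c (t + 1) ∧ u ≠ c (t - 1) ∧ s(c t, u) ∈ bd f ∧ s(c t, u) ∈ bd f' := by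
  obtain ⟨u, hu, hu1, hu2, -, hall⟩ := h.exists_third_edge (ha t) (adj_cyclic_prev ha t)
    (hc.ne (cyclic_add_one_ne_sub_one hn t))
  obtain ⟨h1, h2, h3⟩ := hall f hf
  obtain ⟨h1', h2', h3'⟩ := hall f' hf'
  by_cases hb : s(c t, c (t + 1)) ∈ bd f
  · by_cases hb' : s(c t, c (t + 1)) ∈ bd f'
    · rw [side_of_next hb, side_of_next hb'] at hs
      exact Or.inl (h.face_unique hb hb' hs)
    · by_cases hp : s(c t, c (t - 1)) ∈ bd f
      · have hp' := h1'.resolve_left hb'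
        rw [side_of_prev h hn hc hp, side_of_prev h hn hc hp', add_left_inj] at hs
        exact Or.inl (h.face_unique hp hp' hs)
      · exact Or.inr ⟨u, hu1, hu2, h3.resolve_left hp, h2'.resolve_left hb'⟩
  · have hp := h1.resolve_left hb
    by_cases hp' : s(c t, c (t - 1)) ∈ bd f'
    · rw [side_of_prev h hn hc hp, side_of_prev h hn hc hp', add_left_inj] at hs
      exact Or.inl (h.face_unique hp hp' hs)
    · exact Or.inr ⟨u, hu1, hu2, h2.resolve_left hb, h3'.resolve_left hp'⟩

/-- If the faces differ, one contains the next cycle edge and the other the previous one. Passing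
from the first of these edges to `u`, across `u`, and on to the second flips `chi` three times,
which cancels against the `+ 1` in `side`. -/
theorem side_eq_of_glued (h : IsAlternating G bd pos) (hn : 3 ≤ n)
    (hc : Function.Injective c) (ha : ∀ t, G.Adj (c t) (c (t + 1))) {t : ZMod n} {f f' : F} {u : V}
    (hu1 : u ≠ c (t + 1)) (hu2 : u ≠ c (t - 1)) (hf : s(c t, u) ∈ bd f)
    (hf' : s(c t, u) ∈ bd f') : side bd pos c t f = side bd pos c t f' := by
  by_cases hff : f = f'
  · rw [hff]
  have hcne := hc.ne (cyclic_add_one_ne_sub_one hn t)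
  obtain ⟨x, hx, hx1, hx2, hx3, hall⟩ := h.exists_third_edge (ha t) (adj_cyclic_prev ha t) hcne
  obtain ⟨h1, -, -⟩ := hall f ⟨_, hf, Sym2.mem_mk_left _ _⟩
  obtain ⟨h1', -, -⟩ := hall f' ⟨_, hf', Sym2.mem_mk_left _ _⟩
  have hflip := h.chi_other_face hf hf' hff
  have h2 : ∀ x : ZMod 2, x + 1 + 1 = x := by decide
  by_cases hb : s(c t, c (t + 1)) ∈ bd f
  · have hp' : s(c t, c (t - 1)) ∈ bd f' := by
      refine h1'.resolve_left fun hb' => ?_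
      exact h.not_two_common_edges (adj_cyclic_prev ha t) hcne.symm hu2.symm hu1.symm hff hb hf
        hb' hf'
    rw [side_of_next hb, side_of_prev h hn hc hp', h.chi_other_edge hf hb hu1,
      h.chi_other_edge hf' hp' hu2, hflip, h2]
  · have hp := h1.resolve_left hb
    have hb' : s(c t, c (t + 1)) ∈ bd f' := by
      refine h1'.resolve_right fun hp' => ?_
      exact h.not_two_common_edges (ha t) hcne hu1.symm hu2.symm hff hp hf hp' hf'
    rw [side_of_next hb', side_of_prev h hn hc hp, h.chi_other_edge hf hp hu2,
      h.chi_other_edge hf' hb' hu1, hflip]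

end Side

/-! ### One-sidedness and the parity of the length -/

section OneSided

variable {G : SimpleGraph V} {bd pos : F → Set (Sym2 V)} {n : ℕ} {c : ZMod n → V}
  {C : Set (Sym2 V)}

/-- Corners with equal `side` at one vertex are joined, and each step along the cycle changes
`side`; an odd number of steps leads back to the same vertex on the other side. -/
theorem oneSided_of_odd (h : IsAlternating G bd pos) (hn : 3 ≤ n) (hc : Function.Injective c)
    (ha : ∀ t, G.Adj (c t) (c (t + 1))) (hC : ∀ e, e ∈ C ↔ ∃ t, e = s(c t, c (t + 1)))
    (hodd : Odd n) : OneSided bd C := by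
  have hnz : NeZero n := ⟨by omega⟩
  have hon : ∀ t, ∃ e ∈ C, c t ∈ e := fun t =>
    ⟨_, (hC _).2 ⟨t, rfl⟩, Sym2.mem_mk_left _ _⟩
  let K : ∀ t f, Touches bd (c t) f →
      {x : V × F // (∃ e ∈ C, x.1 ∈ e) ∧ Touches bd x.1 x.2} := fun t f hf => ⟨(c t, f), hon t, hf⟩
  -- corners on the same side at one vertex
  have same : ∀ t f f' (hf : Touches bd (c t) f) (hf' : Touches bd (c t) f'),
      side bd pos c t f = side bd pos c t f' →
      (sideGraph bd C).Reachable (K t f hf) (K t f' hf') := by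
    intro t f f' hf hf' hs
    by_cases hff : f = f'
    · subst hff
      rfl
    obtain ⟨u, hu1, hu2, hu, hu'⟩ := (eq_or_glued_of_side_eq h hn hc ha hf hf' hs).resolve_left hff
    refine SimpleGraph.Adj.reachable ?_
    rw [sideGraph, SimpleGraph.fromRel_adj]
    refine ⟨fun hh => hff (congrArg (fun x => x.1.2) hh), Or.inl (Or.inl ⟨rfl, s(c t, u), ?_,
      Sym2.mem_mk_left _ _, hu, hu'⟩)⟩
    rw [hC, mk_mem_cyclic_iff hc]
    tauto
  -- one step along the cycle
  have step : ∀ t f (hf : Touches bd (c t) f), ∃ g, ∃ hg : Touches bd (c (t + 1)) g,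
      side bd pos c (t + 1) g = side bd pos c t f + 1 ∧
      (sideGraph bd C).Reachable (K t f hf) (K (t + 1) g hg) := by
    intro t f hf
    -- Before moving on, pass to the face at the next cycle edge that lies on the same side as `f`.
    obtain ⟨g, hg, hgs⟩ := h.exists_face (ha t) (side bd pos c t f)
    have hg1 : Touches bd (c t) g := ⟨_, hg, Sym2.mem_mk_left _ _⟩
    have hg2 : Touches bd (c (t + 1)) g := ⟨_, hg, Sym2.mem_mk_right _ _⟩
    have hgf : side bd pos c t f = side bd pos c t g := by rw [side_of_next hg, hgs]
    refine ⟨g, hg2, by rw [side_add_one h hn hc hg, hgf], (same t f g hf hg1 hgf).trans ?_⟩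
    refine SimpleGraph.Adj.reachable ?_
    rw [sideGraph, SimpleGraph.fromRel_adj]
    refine ⟨fun hh => (ha t).ne (congrArg (fun x => x.1.1) hh), Or.inl (Or.inr ⟨rfl, ?_, hg⟩)⟩
    exact (hC _).2 ⟨t, rfl⟩
  have steps : ∀ (m : ℕ) t f (hf : Touches bd (c t) f), ∃ g, ∃ hg : Touches bd (c (t + m)) g,
      side bd pos c (t + m) g = side bd pos c t f + m ∧
      (sideGraph bd C).Reachable (K t f hf) (K (t + m) g hg) := by
    intro m
    induction m with
    | zero =>
      intro t f hf
      have e : t + ((0 : ℕ) : ZMod n) = t := by simp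
      rw [e]
      exact ⟨f, hf, by simp, SimpleGraph.Reachable.refl _⟩
    | succ m ih =>
      intro t f hf
      obtain ⟨g, hg, h1, h2⟩ := ih t f hf
      obtain ⟨g', hg', h1', h2'⟩ := step _ g hg
      have e : t + ((m + 1 : ℕ) : ZMod n) = t + m + 1 := by push_cast; ring
      rw [e]
      refine ⟨g', hg', ?_, h2.trans h2'⟩
      rw [h1', h1]
      push_cast
      ring
  have around : ∀ t f f' (hf : Touches bd (c t) f) (hf' : Touches bd (c t) f'),
      (sideGraph bd C).Reachable (K t f hf) (K t f' hf') := by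
    intro t f f' hf hf'
    have h2 : ∀ x y : ZMod 2, x = y ∨ x + 1 = y := by decide
    rcases h2 (side bd pos c t f) (side bd pos c t f') with hs | hs
    · exact same t f f' hf hf' hs
    -- One full turn exchanges the sides, as `n` is odd.
    · have := steps n t f hf
      have e : t + (n : ZMod n) = t := by simp
      rw [e] at this
      obtain ⟨g, hg, h1, h3⟩ := this
      refine h3.trans (same t g f' hg hf' ?_)
      rw [h1, ← hs, (ZMod.natCast_eq_one_iff_odd).2 hodd]
  have key : ∀ x, ∃ t f hf, x = K t f hf := by
    rintro ⟨⟨v, f⟩, ⟨e, he, hv⟩, hf⟩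
    obtain ⟨t, rfl⟩ := (hC e).1 he
    rcases Sym2.mem_iff.1 hv with hv | hv
    · have hv' : v = c t := hv
      subst hv'
      exact ⟨t, f, hf, rfl⟩
    · have hv' : v = c (t + 1) := hv
      subst hv'
      exact ⟨t + 1, f, hf, rfl⟩
  obtain ⟨f₀, hf₀, -⟩ := h.exists_face (ha 0) 0
  have : Nonempty {x : V × F // (∃ e ∈ C, x.1 ∈ e) ∧ Touches bd x.1 x.2} :=
    ⟨K 0 f₀ ⟨_, hf₀, Sym2.mem_mk_left _ _⟩⟩
  refine SimpleGraph.Connected.mk fun x y => ?_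
  obtain ⟨t, f, hf, rfl⟩ := key x
  obtain ⟨r, g, hg, rfl⟩ := key y
  have := steps (r - t).val t f hf
  have e : t + ((r - t).val : ZMod n) = r := by
    rw [ZMod.natCast_zmod_val]
    ring
  rw [e] at this
  obtain ⟨g', hg', -, h1⟩ := this
  exact h1.trans (around r g' g hg' hg)

/-- For even `n` the index along the cycle has a parity, and `side` plus this parity is constant on
components of the side graph; yet it differs on the two faces at one edge. -/
theorem not_oneSided_of_even (h : IsAlternating G bd pos) (hn : 3 ≤ n) (hc : Function.Injective c)
    (ha : ∀ t, G.Adj (c t) (c (t + 1))) (hC : ∀ e, e ∈ C ↔ ∃ t, e = s(c t, c (t + 1)))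
    (heven : Even n) : ¬ OneSided bd C := by
  intro hconn
  have hdvd : 2 ∣ n := heven.two_dvd
  let π : ZMod n →+* ZMod 2 := ZMod.castHom hdvd (ZMod 2)
  -- The default value off the cycle is harmless: every corner of the side graph sits at some `c t`.
  let τ : V → ZMod n := Function.invFun c
  have hτ : ∀ t, τ (c t) = t := Function.leftInverse_invFun hc
  have hon : ∀ t, ∃ e ∈ C, c t ∈ e := fun t => ⟨_, (hC _).2 ⟨t, rfl⟩, Sym2.mem_mk_left _ _⟩
  let Φ : {x : V × F // (∃ e ∈ C, x.1 ∈ e) ∧ Touches bd x.1 x.2} → ZMod 2 :=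
    fun x => side bd pos c (τ x.1.1) x.1.2 + π (τ x.1.1)
  have h2 : (1 : ZMod 2) + 1 = 0 := by decide
  have hedge : ∀ t f, s(c t, c (t + 1)) ∈ bd f → side bd pos c t f + π t =
      side bd pos c (t + 1) f + π (t + 1) := by
    intro t f hf
    rw [side_add_one h hn hc hf, map_add, map_one]
    linear_combination -h2
  have hrel : ∀ x y : {x : V × F // (∃ e ∈ C, x.1 ∈ e) ∧ Touches bd x.1 x.2},
      ((x.1.1 = y.1.1 ∧ ∃ e, e ∉ C ∧ x.1.1 ∈ e ∧ e ∈ bd x.1.2 ∧ e ∈ bd y.1.2) ∨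
      (x.1.2 = y.1.2 ∧ s(x.1.1, y.1.1) ∈ C ∧ s(x.1.1, y.1.1) ∈ bd x.1.2)) → Φ x = Φ y := by
    rintro ⟨⟨v, f⟩, ⟨e, he, hv⟩, hf⟩ ⟨⟨v', f'⟩, _, hf'⟩ (⟨h1, e', he', hv', h3, h4⟩ | ⟨h1, h3, h4⟩)
    · dsimp only at h1 hv' h3 h4 hv
      subst h1
      have : ∃ t, v = c t := by
        obtain ⟨t, rfl⟩ := (hC e).1 he
        rcases Sym2.mem_iff.1 hv with rfl | rfl <;> exact ⟨_, rfl⟩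
      obtain ⟨t, rfl⟩ := this
      obtain ⟨u, rfl⟩ := hv'
      rw [hC, mk_mem_cyclic_iff hc] at he'
      push Not at he'
      simp only [Φ, hτ]
      rw [side_eq_of_glued h hn hc ha he'.1 he'.2 h3 h4]
    · dsimp only at h1 h3 h4
      subst h1
      obtain ⟨t, ht⟩ := (hC _).1 h3
      rcases Sym2.eq_iff.1 ht with ⟨rfl, rfl⟩ | ⟨rfl, rfl⟩
      · simp only [Φ, hτ]
        exact hedge t f h4
      · simp only [Φ, hτ]
        rw [Sym2.eq_swap] at h4
        exact (hedge t f h4).symm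
  have hwalk : ∀ x y, (sideGraph bd C).Reachable x y → Φ x = Φ y := by
    rintro x y ⟨p⟩
    induction p with
    | nil => rfl
    | cons hadj _ ih =>
      rw [← ih]
      rw [sideGraph, SimpleGraph.fromRel_adj] at hadj
      rcases hadj.2 with h' | h'
      · exact hrel _ _ h'
      · exact (hrel _ _ h').symm
  obtain ⟨f, hf, hf0⟩ := h.exists_face (ha 0) 0
  obtain ⟨g, hg, hg1⟩ := h.exists_face (ha 0) 1
  have := hwalk ⟨(c 0, f), hon 0, ⟨_, hf, Sym2.mem_mk_left _ _⟩⟩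
    ⟨(c 0, g), hon 0, ⟨_, hg, Sym2.mem_mk_left _ _⟩⟩ (hconn.preconnected _ _)
  simp only [Φ, hτ] at this
  rw [side_of_next hf, side_of_next hg, hf0, hg1] at this
  simp at this

end OneSided

/-- In an alternating map a cycle is one-sided exactly if its length is odd. -/
theorem IsAlternating.odd_length_iff_oneSided {G : SimpleGraph V} {bd pos : F → Set (Sym2 V)}
    (h : IsAlternating G bd pos) {v : V} {w : G.Walk v v} (hw : w.IsCycle) :
    Odd w.length ↔ OneSided bd {e | e ∈ w.edges} := by
  obtain ⟨c, hc, ha, hd⟩ := exists_cyclic_param hw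
  have hC : ∀ e, e ∈ {e | e ∈ w.edges} ↔ ∃ t, e = s(c t, c (t + 1)) :=
    mem_edges_iff_cyclic ha hd
  refine ⟨oneSided_of_odd h hw.three_le_length hc ha hC, fun hone => ?_⟩
  by_contra hodd
  exact not_oneSided_of_even h hw.three_le_length hc ha hC (Nat.not_odd_iff_even.1 hodd) hone

/-! ### Orientations and 2-colourings -/

open Classical in
/-- An orientation of an alternating map gives a proper colouring of its graph by two colours. -/
theorem IsAlternating.exists_two_coloring {G : SimpleGraph V} {bd pos : F → Set (Sym2 V)}
    (h : IsAlternating G bd pos) (ho : Orientable G bd) :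
    ∃ η : V → ZMod 2, ∀ v u, G.Adj v u → η u = η v + 1 := by
  obtain ⟨b, w, hw, hd⟩ := ho
  let D : V → V → F → Prop := fun v u f => ∃ ha : G.Adj v u, (⟨(v, u), ha⟩ : G.Dart) ∈ (w f).darts
  let o : V → V → F → ZMod 2 := fun v u f => if D v u f then 1 else 0
  have h11 : (1 : ZMod 2) + 1 = 0 := by decide
  -- A directed facial cycle uses each of its edges in one direction only, and at each of its
  -- vertices one edge leaves and the other enters.
  have hcyc : ∀ f v u, s(v, u) ∈ bd f → (D v u f ∨ D u v f) ∧ ¬ (D v u f ∧ D u v f) ∧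
      ∀ u', s(v, u') ∈ bd f → u ≠ u' → (D v u' f ↔ ¬ D v u f) := by
    intro f
    have h3 := (hw f).1.three_le_length
    obtain ⟨c, hc, ha, hdc⟩ := exists_cyclic_param (hw f).1
    have hC := mem_edges_iff_cyclic ha hdc
    have hDc : ∀ v u, D v u f ↔ ∃ t, v = c t ∧ u = c (t + 1) := by
      intro v u
      constructor
      · rintro ⟨hvu, hm⟩
        exact (hdc _).1 hm
      · rintro ⟨t, rfl, rfl⟩
        exact ⟨ha t, (hdc _).2 ⟨t, rfl, rfl⟩⟩
    have hnext : ∀ t u, D (c t) u f ↔ u = c (t + 1) := by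
      intro t u
      rw [hDc]
      constructor
      · rintro ⟨r, hr, rfl⟩
        rw [hc hr]
      · rintro rfl
        exact ⟨t, rfl, rfl⟩
    have hpm : ∀ t, c (t + 1) ≠ c (t - 1) := fun t => hc.ne (cyclic_add_one_ne_sub_one h3 t)
    have hprev : ∀ t, ¬ D (c t) (c (t - 1)) f := fun t ht => hpm t ((hnext t _).1 ht).symm
    have hmem : ∀ t u, s(c t, u) ∈ bd f → u = c (t + 1) ∨ u = c (t - 1) := by
      intro t u hu
      rw [← (hw f).2, hC] at hu
      exact (mk_mem_cyclic_iff hc t u).1 hu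
    have hback : ∀ t, D (c (t - 1)) (c t) f := fun t => by
      rw [hnext, sub_add_cancel]
    intro v u hvu
    have : ∃ t, v = c t := by
      have hvu' := hvu
      rw [← (hw f).2, hC] at hvu'
      obtain ⟨t, ht⟩ := hvu'
      rcases Sym2.eq_iff.1 ht with ⟨h1, -⟩ | ⟨h1, -⟩
      · exact ⟨_, h1⟩
      · exact ⟨_, h1⟩
    obtain ⟨t, rfl⟩ := this
    have hfwd : ¬ D (c (t + 1)) (c t) f := by
      have := hprev (t + 1)
      rwa [add_sub_cancel_right] at this
    rcases hmem t u hvu with rfl | rfl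
    · refine ⟨Or.inl ((hnext _ _).2 rfl), fun hh => hfwd hh.2, fun u' hu' hne => ?_⟩
      rcases hmem t u' hu' with rfl | rfl
      · exact absurd rfl hne
      · exact iff_of_false (hprev t) (not_not_intro ((hnext _ _).2 rfl))
    · refine ⟨Or.inr (hback t), fun hh => hprev t hh.1, fun u' hu' hne => ?_⟩
      rcases hmem t u' hu' with rfl | rfl
      · exact iff_of_true ((hnext _ _).2 rfl) (hprev t)
      · exact absurd rfl hne
  have hflip : ∀ (p q : Prop) [Decidable p] [Decidable q], (p ↔ ¬ q) → (if p then (1 : ZMod 2) else 0) =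
      (if q then (1 : ZMod 2) else 0) + 1 := by
    intro p q _ _ hpq
    by_cases hq : q
    · simp [hq, hpq, h11]
    · simp [hq, hpq]
  have hface : ∀ v u f f', s(v, u) ∈ bd f → s(v, u) ∈ bd f' → f ≠ f' → o v u f' = o v u f + 1 := by
    intro v u f f' hf hf' hne
    refine hflip (D v u f') (D v u f) ⟨fun ⟨a1, h1⟩ ⟨a2, h2⟩ => hd f f' hne _ h2 h1, fun hn => ?_⟩
    by_contra hn'
    obtain ⟨a1, h1⟩ := (hcyc f v u hf).1.resolve_left hn
    obtain ⟨a2, h2⟩ := (hcyc f' v u hf').1.resolve_left hn'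
    exact hd f f' hne _ h1 h2
  have hedge : ∀ v u u' f, s(v, u) ∈ bd f → s(v, u') ∈ bd f → u ≠ u' →
      o v u' f = o v u f + 1 := fun v u u' f hu hu' hne =>
    hflip _ _ ((hcyc f v u hu).2.2 u' hu' hne)
  have hrev : ∀ v u f, s(v, u) ∈ bd f → o u v f = o v u f + 1 := by
    intro v u f hf
    have := hcyc f v u hf
    exact hflip _ _ ⟨fun h1 h2 => this.2.1 ⟨h2, h1⟩, fun hn => this.1.resolve_left hn⟩
  -- At `v`, both `o` and `chi` flip with the face and with the edge, so their sum depends on `v`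
  -- alone. It tells whether the global orientation agrees with the local one. Reversing an edge
  -- flips `o` but not `chi`, hence the sum changes between neighbours.
  have hc1 : ∀ v u f f', s(v, u) ∈ bd f → s(v, u) ∈ bd f' →
      o v u f + chi pos s(v, u) f = o v u f' + chi pos s(v, u) f' := by
    intro v u f f' hf hf'
    by_cases hff : f = f'
    · rw [hff]
    · rw [hface v u f f' hf hf' hff, h.chi_other_face hf hf' hff]
      linear_combination -h11
  have hc2 : ∀ v u u' f, s(v, u) ∈ bd f → s(v, u') ∈ bd f →
      o v u f + chi pos s(v, u) f = o v u' f + chi pos s(v, u') f := by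
    intro v u u' f hf hf'
    by_cases hff : u = u'
    · rw [hff]
    · rw [hedge v u u' f hf hf' hff, h.chi_other_edge hf hf' hff]
      linear_combination -h11
  have hconst : ∀ v u u' f f', s(v, u) ∈ bd f → s(v, u') ∈ bd f' →
      o v u f + chi pos s(v, u) f = o v u' f' + chi pos s(v, u') f' := by
    intro v u u' f f' hf hf'
    obtain ⟨g, hg, hg'⟩ := h.exists_common_face (h.adj hf) (h.adj hf')
    rw [hc1 v u f g hf hg, hc2 v u u' g hg hg', hc1 v u' g f' hg' hf']
  have hex : ∀ v, ∃ x, ∀ u f, s(v, u) ∈ bd f → o v u f + chi pos s(v, u) f = x := by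
    intro v
    obtain ⟨nb, fc, H⟩ := h.corner v
    exact ⟨_, fun u f hf => hconst v u (nb 0) f (fc 1) hf ((H.mem_iff 0 1).2 (by decide))⟩
  choose η hη using hex
  refine ⟨η, fun v u hvu => ?_⟩
  obtain ⟨f, hf, -⟩ := h.exists_face hvu 0
  have hf' : s(u, v) ∈ bd f := by rwa [Sym2.eq_swap]
  rw [← hη v u f hf, ← hη u v f hf', hrev v u f hf, Sym2.eq_swap]
  ring

end SurfaceMap

/-! ### Hexagons and edge counting -/

namespace SurfaceMap

variable {V F : Type*}

/-- The neighbour of a corner of a hexagon along its edge with an even number. -/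
def evenNbr (r : Fin 6) : Fin 6 := if r.val % 2 = 0 then r + 1 else r - 1

/-- The neighbour of a corner of a hexagon along its edge with an odd number. -/
def oddNbr (r : Fin 6) : Fin 6 := if r.val % 2 = 0 then r - 1 else r + 1

theorem mem_hexagon_iff {x : Fin 6 → V} (hx : Function.Injective x) (r : Fin 6) (u : V) :
    (∃ t : Fin 6, s(x r, u) = s(x t, x (t + 1))) ↔ u = x (evenNbr r) ∨ u = x (oddNbr r) := by
  have : (∃ t : Fin 6, s(x r, u) = s(x t, x (t + 1))) ↔ u = x (r + 1) ∨ u = x (r - 1) :=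
    mk_mem_cyclic_iff (n := 6) hx r u
  rw [this, evenNbr, oddNbr]
  split_ifs
  · rfl
  · exact or_comm

theorem mem_even_hexagon_iff {x : Fin 6 → V} (hx : Function.Injective x) (r : Fin 6) (u : V) :
    (∃ t : Fin 6, t.val % 2 = 0 ∧ s(x r, u) = s(x t, x (t + 1))) ↔ u = x (evenNbr r) := by
  have h0 : ∀ t : Fin 6, t.val % 2 = 0 → evenNbr t = t + 1 ∧ evenNbr (t + 1) = t := by decide
  constructor
  · rintro ⟨t, ht, h⟩
    rcases Sym2.eq_iff.1 h with ⟨h1, h2⟩ | ⟨h1, h2⟩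
    · rw [hx h1, h2, (h0 t ht).1]
    · rw [hx h1, h2, (h0 t ht).2]
  · rintro rfl
    have h2 : ∀ r : Fin 6, ∃ t : Fin 6, t.val % 2 = 0 ∧
      ((r = t ∧ evenNbr r = t + 1) ∨ (r = t + 1 ∧ evenNbr r = t)) := by decide
    obtain ⟨t, ht, ⟨e1, e2⟩ | ⟨e1, e2⟩⟩ := h2 r
    · exact ⟨t, ht, by rw [e2, e1]⟩
    · exact ⟨t, ht, by rw [e2, e1, Sym2.eq_swap]⟩

/-- A vertex surrounded by three hexagons is alternating. -/
theorem alternatingAt_of_hexagons {G : SimpleGraph V} {bd pos : F → Set (Sym2 V)} {v : V}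
    {nb : Fin 3 → V} {fc : Fin 3 → F} (hnb : Function.Injective nb)
    (hadj : ∀ u, G.Adj v u ↔ ∃ l, u = nb l) (htouch : ∀ f, Touches bd v f → ∃ m, f = fc m)
    (x : Fin 3 → Fin 6 → V) (hx : ∀ m, Function.Injective (x m))
    (hbd : ∀ m e, e ∈ bd (fc m) ↔ ∃ t : Fin 6, e = s(x m t, x m (t + 1)))
    (hpos : ∀ m e, e ∈ pos (fc m) ↔ ∃ t : Fin 6, t.val % 2 = 0 ∧ e = s(x m t, x m (t + 1)))
    (r : Fin 3 → Fin 6) (hv : ∀ m, x m (r m) = v) (heven : ∀ m, x m (evenNbr (r m)) = nb (m + 1))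
    (hodd : ∀ m, x m (oddNbr (r m)) = nb (m + 2)) : AlternatingAt G bd pos v nb fc := by
  refine ⟨hnb, hadj, htouch, fun l m => ?_, fun l m => ?_⟩
  · rw [← hv m, hbd, mem_hexagon_iff (hx m), heven, hodd, hnb.eq_iff, hnb.eq_iff]
    decide +revert
  · rw [← hv m, hpos, mem_even_hexagon_iff (hx m), heven, hnb.eq_iff]

theorem exists_bounds_of_hexagon {G : SimpleGraph V} {bd : F → Set (Sym2 V)} {f : F}
    {x : Fin 6 → V} (hx : Function.Injective x) (hsub : bd f ⊆ G.edgeSet)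
    (hbd : ∀ e, e ∈ bd f ↔ ∃ t : Fin 6, e = s(x t, x (t + 1))) :
    ∃ (v : V) (w : G.Walk v v), Bounds G bd f w := by
  have ha : ∀ t : Fin 6, G.Adj (x t) (x (t + 1)) := fun t => hsub ((hbd _).2 ⟨t, rfl⟩)
  refine ⟨x 0, .cons (ha 0) (.cons (ha 1) (.cons (ha 2) (.cons (ha 3) (.cons (ha 4)
    (.cons (ha 5) .nil))))), ?_, ?_⟩
  · rw [SimpleGraph.Walk.cons_isCycle_iff]
    constructor
    · simp [SimpleGraph.Walk.cons_isPath_iff, hx.eq_iff]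
    · simp [hx.eq_iff]
  · intro e
    rw [hbd]
    simp only [SimpleGraph.Walk.edges_cons, SimpleGraph.Walk.edges_nil, List.mem_cons,
      List.not_mem_nil, or_false]
    constructor
    · rintro (h | h | h | h | h | h)
      exacts [⟨0, h⟩, ⟨1, h⟩, ⟨2, h⟩, ⟨3, h⟩, ⟨4, h⟩, ⟨5, h⟩]
    · rintro ⟨t, rfl⟩
      fin_cases t <;> simp

theorem IsAlternating.two_mul_card_edgeSet {G : SimpleGraph V} {bd pos : F → Set (Sym2 V)}
    [Finite V] (h : IsAlternating G bd pos) : 2 * Nat.card G.edgeSet = 3 * Nat.card V := by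
  classical
  have := Fintype.ofFinite V
  have hdeg : ∀ v, G.degree v = 3 := by
    intro v
    obtain ⟨nb, fc, H⟩ := h.corner v
    have : G.neighborFinset v = Finset.univ.image nb := by
      ext u
      simp only [SimpleGraph.mem_neighborFinset, H.adj_iff, Finset.mem_image, Finset.mem_univ,
        true_and, eq_comm]
    rw [← SimpleGraph.card_neighborFinset_eq_degree, this,
      Finset.card_image_of_injective _ H.nb_inj]
    simp
  have hs := G.sum_degrees_eq_twice_card_edges
  simp only [hdeg, Finset.sum_const, Finset.card_univ, smul_eq_mul] at hs
  rw [Nat.card_eq_fintype_card, Nat.card_eq_fintype_card, ← SimpleGraph.edgeFinset_card, ← hs,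
    mul_comm]

end SurfaceMap

/-! ### The covering of the polyhex by the plane lattice -/

namespace Ko

open SurfaceMap

/-- The map from the plane lattice `ℤ × ℤ` that is invariant under the translation by `(0, q)` and
the glide reflection `(i, j) ↦ (i + k, s - j)`. -/
def cov (k q : ℕ) (s i j : ℤ) : Vert k q :=
  ((i : ZMod k), if Even (i / k) then (j : ZMod q) else ((s - j : ℤ) : ZMod q))

/-- The second coordinate of the image of a point `(i, j)` under the deck transformation that adds
`m * k` to the first coordinate. -/
def deck (q : ℕ) (s m t j : ℤ) : ℤ := if Even m then j + t * q else s - j + t * q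

/-- The sum of the second coordinates of two points that are interchanged by the reflection
involved in gluing the ends of the lattice. -/
def shift (k : ℕ) : ℤ := if Even k then -1 else -2

section Cover

variable {k q : ℕ}

theorem cov_deck (hk : k ≠ 0) (s m t i j : ℤ) :
    cov k q s (i + m * k) (deck q s m t j) = cov k q s i j := by
  have hk' : (k : ℤ) ≠ 0 := by exact_mod_cast hk
  simp only [cov, deck, Int.add_mul_ediv_right _ _ hk', Int.even_add]
  refine Prod.ext (by simp) ?_
  by_cases hm : Even m <;> by_cases hi : Even (i / (k : ℤ)) <;> simp [hm, hi]

/-- The fibres of `cov` are single orbits of the deck group, so coincidences downstairs can be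
analysed in the plane. -/
theorem exists_deck_of_cov_eq (hk : k ≠ 0) {s i j i' j' : ℤ}
    (h : cov k q s i j = cov k q s i' j') :
    ∃ m t : ℤ, i' = i + m * k ∧ j' = deck q s m t j := by
  have hk' : (k : ℤ) ≠ 0 := by exact_mod_cast hk
  have h1 : (i : ZMod k) = (i' : ZMod k) := congrArg Prod.fst h
  rw [ZMod.intCast_eq_intCast_iff_dvd_sub] at h1
  obtain ⟨m, hm⟩ := h1
  have hi' : i' = i + m * k := by linear_combination hm
  subst hi'
  have h2 : cov k q s i (deck q s m 0 j') = cov k q s i j := by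
    have hmm : Even (-m) ↔ Even m := even_neg
    have := cov_deck (q := q) hk s (-m) 0 (i + m * k) j'
    rw [← h] at this
    rw [← this, show i + m * k + -m * k = i by ring]
    simp only [deck, hmm]
  have h3 : (q : ℤ) ∣ j - deck q s m 0 j' := by
    rw [← ZMod.intCast_eq_intCast_iff_dvd_sub]
    have h4 := congrArg Prod.snd h2
    simp only [cov] at h4
    split_ifs at h4
    · exact h4
    · push_cast at h4
      exact sub_right_inj.1 h4
  obtain ⟨t, ht⟩ := h3
  by_cases hm2 : Even m
  · refine ⟨m, -t, rfl, ?_⟩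
    simp only [deck, if_pos hm2] at ht ⊢
    linear_combination -ht
  · refine ⟨m, t, rfl, ?_⟩
    simp only [deck, if_neg hm2] at ht ⊢
    linear_combination ht

/-- A glide reflection changes `i + j` by `k + s` modulo 2. The case `s ≡ k` is that of lower left
corners of hexagons, with `s = shift k - 1`; the next lemma treats vertices, with `s = shift k`,
whose two parity classes are exchanged. -/
theorem even_deck_iff (hq : Even q) (s m t i j : ℤ) (hs : Even s ↔ Even k) :
    Even (i + m * k + deck q s m t j) ↔ Even (i + j) := by
  have hq' : Even (q : ℤ) := by exact_mod_cast hq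
  have hk' : Even (k : ℤ) ↔ Even k := by norm_cast
  by_cases hm : Even m <;>
    simp only [deck, hm, if_true, if_false, Int.even_add, Int.even_mul, Int.even_sub, hq', hs, hk']
    <;> tauto

theorem even_deck_iff' (hq : Even q) (s m t i j : ℤ) (hs : Even s ↔ ¬ Even k) :
    Even (i + m * k + deck q s m t j) ↔ (Even (i + j) ↔ Even m) := by
  have hq' : Even (q : ℤ) := by exact_mod_cast hq
  have hk' : Even (k : ℤ) ↔ Even k := by norm_cast
  by_cases hm : Even m <;>
    simp only [deck, hm, if_true, if_false, Int.even_add, Int.even_mul, Int.even_sub, hq', hs, hk']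
    <;> tauto

theorem even_shift (k : ℕ) : Even (shift k) ↔ ¬ Even k := by
  by_cases h : Even k
  · simp only [shift, h]
    decide
  · simp only [shift, h]
    decide

theorem even_shift_sub_one (k : ℕ) : Even (shift k - 1) ↔ Even k := by
  rw [Int.even_sub, even_shift]
  simp

/-- The covering map is injective on sets that are less than `k` wide, except for translations. -/
theorem cov_inj (hk : 3 ≤ k) (hq : Even q) {s i j i' j' : ℤ}
    (h : cov k q s i j = cov k q s i' j') (h1 : -2 ≤ i - i') (h2 : i - i' ≤ 2) :
    i = i' ∧ (j - j') % 2 = 0 := by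
  obtain ⟨m, t, rfl, rfl⟩ := exists_deck_of_cov_eq (by omega) h
  have hk' : (3 : ℤ) ≤ k := by exact_mod_cast hk
  have hm : m = 0 := by
    by_contra hm
    rcases lt_or_gt_of_ne hm with hlt | hgt
    · nlinarith
    · nlinarith
  subst hm
  -- Since `q = 2` is allowed, only the parity of `j - j'` can be controlled; this suffices to tell
  -- the corners of a hexagon apart.
  obtain ⟨q', rfl⟩ := hq
  refine ⟨by ring, ?_⟩
  simp only [deck, Even.zero, if_true]
  push_cast
  rw [show j - (j + t * (q' + q')) = 2 * (-(t * q')) by ring]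
  exact Int.mul_emod_right _ _

/-- Every point has an image in the fundamental domain. -/
theorem exists_fundamental (hk : k ≠ 0) (hq : q ≠ 0) (s i j : ℤ) : ∃ (m t : ℤ) (a b : ℕ),
    a < k ∧ b < q ∧ i + m * k = a ∧ deck q s m t j = b := by
  have hk' : (k : ℤ) ≠ 0 := by exact_mod_cast hk
  have hq' : (q : ℤ) ≠ 0 := by exact_mod_cast hq
  obtain ⟨a, ha⟩ := Int.eq_ofNat_of_zero_le (Int.emod_nonneg i hk')
  have ha' := Int.emod_lt_of_pos i (b := k) (by omega)
  obtain ⟨b, hb⟩ := Int.eq_ofNat_of_zero_le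
    (Int.emod_nonneg (if Even (-(i / (k : ℤ))) then j else s - j) hq')
  have hb' := Int.emod_lt_of_pos (if Even (-(i / (k : ℤ))) then j else s - j) (b := q) (by omega)
  refine ⟨-(i / k), -((if Even (-(i / (k : ℤ))) then j else s - j) / q), a, b, by omega, by omega,
    ?_, ?_⟩
  · rw [← ha, Int.emod_def]
    ring
  · rw [← hb, Int.emod_def, deck]
    split_ifs <;> ring

end Cover

/-- The vertex of `K_o(k, q)` below the point `(i, j)` of the plane lattice. -/
def vert (k q : ℕ) (i j : ℤ) : Vert k q := cov k q (shift k) i j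

/-- `(a, b)` is the lower left corner of a hexagon of the plane lattice above the face `f`. -/
def Rep (k q : ℕ) (f : Face k q) (a b : ℤ) : Prop :=
  Even (a + b) ∧ cov k q (shift k - 1) f.1.1 f.1.2 = cov k q (shift k - 1) a b

/-- The first coordinates of the corners of a hexagon. -/
def hexX : Fin 6 → ℤ := ![0, 1, 2, 2, 1, 0]

/-- The second coordinates of the corners of a hexagon. -/
def hexY : Fin 6 → ℤ := ![0, 0, 0, 1, 1, 1]

/-- The corners of the hexagon with the lower left corner `(a, b)`. -/
def hex (k q : ℕ) (a b : ℤ) (t : Fin 6) : Vert k q := vert k q (a + hexX t) (b + hexY t)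

/-- Every second edge of the face `f`. -/
def evenBd (k q : ℕ) (f : Face k q) : Set (Sym2 (Vert k q)) :=
  {e | ∃ t : Fin 6, t.val % 2 = 0 ∧ e = s(hex k q f.1.1 f.1.2 t, hex k q f.1.1 f.1.2 (t + 1))}

section Lattice

variable {k q : ℕ}

theorem pt_eq_vert (hk : k ≠ 0) {a b : ℕ} (ha : a < 2 * k) : pt k q (a, b) = vert k q a b := by
  have hk' : (k : ℤ) ≠ 0 := by exact_mod_cast hk
  by_cases h : a < k
  · have h0 : (a : ℤ) / k = 0 := Int.ediv_eq_zero_of_lt (by omega) (by omega)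
    simp [pt, vert, cov, h, h0]
  · have h1 : (a : ℤ) / k = 1 := by
      rw [show (a : ℤ) = (a - k) + 1 * k by ring, Int.add_mul_ediv_right _ _ hk',
        Int.ediv_eq_zero_of_lt (by omega) (by omega), zero_add]
    have h2 : ((a - k : ℕ) : ZMod k) = a := by
      rw [Nat.cast_sub (by omega)]
      simp
    by_cases hke : Even k
    · simp [pt, vert, cov, shift, h, h1, h2, hke]
    · simp [pt, vert, cov, shift, h, h1, h2, hke]

theorem rep_self (f : Face k q) : Rep k q f f.1.1 f.1.2 := by
  refine ⟨?_, rfl⟩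
  have := f.2.2.2
  rw [Int.even_iff]
  omega

theorem rep_unique {f f' : Face k q} {a b : ℤ} (h : Rep k q f a b)
    (h' : Rep k q f' a b) : f = f' := by
  have h0 : ∀ f : Face k q, (f.1.1 : ℤ) / k = 0 := fun f =>
    Int.ediv_eq_zero_of_lt (by omega) (by have := f.2.1; omega)
  have e := h.2.trans h'.2.symm
  simp only [cov, h0, Even.zero, if_true, Int.cast_natCast, Prod.mk.injEq,
    ZMod.natCast_eq_natCast_iff'] at e
  have h1 := f.2
  have h2 := f'.2
  rw [Nat.mod_eq_of_lt h1.1, Nat.mod_eq_of_lt h2.1, Nat.mod_eq_of_lt h1.2.1,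
    Nat.mod_eq_of_lt h2.2.1] at e
  exact Subtype.ext (Prod.ext e.1 e.2)

theorem exists_rep (hk : k ≠ 0) (hq : Even q) (hq0 : q ≠ 0) {a b : ℤ} (h : Even (a + b)) :
    ∃ f, Rep k q f a b := by
  obtain ⟨m, t, a', b', ha, hb, h1, h2⟩ := exists_fundamental hk hq0 (shift k - 1) a b
  have hpar : Even ((a' : ℤ) + b') := by
    rw [← h1, ← h2, even_deck_iff hq _ _ _ _ _ (even_shift_sub_one k)]
    exact h
  rw [Int.even_iff] at hpar
  refine ⟨⟨(a', b'), ha, hb, by simp only; omega⟩, h, ?_⟩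
  simp only
  rw [← h1, ← h2, cov_deck hk]

theorem rep_deck (hk : k ≠ 0) (hq : Even q) {f : Face k q} {a b : ℤ} (h : Rep k q f a b)
    (m t : ℤ) : Rep k q f (a + m * k) (deck q (shift k - 1) m t b) :=
  ⟨(even_deck_iff hq _ _ _ _ _ (even_shift_sub_one k)).2 h.1, by rw [cov_deck hk]; exact h.2⟩

theorem hex_rev (t : Fin 6) : hexX (5 - t) = hexX t ∧ hexY (5 - t) = 1 - hexY t := by
  decide +revert

/-- A glide reflection exchanges the two rows of a hexagon, so the lower left corner of the image is
one row below the image of the lower left corner. Hence `shift k - 1` for faces against `shift k`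
for vertices, and corner `r` becomes corner `5 - r`. -/
theorem hex_deck (hk : k ≠ 0) (m t a b : ℤ) (r : Fin 6) :
    hex k q (a + m * k) (deck q (shift k - 1) m t b) r =
      hex k q a b (if Even m then r else 5 - r) := by
  by_cases hm : Even m
  · simp only [hex, vert, if_pos hm]
    rw [← cov_deck hk (shift k) m t (a + hexX r)]
    simp only [deck, if_pos hm]
    congr 1 <;> ring
  · simp only [hex, vert, if_neg hm]
    rw [(hex_rev r).1, (hex_rev r).2, ← cov_deck hk (shift k) m t (a + hexX r)]
    simp only [deck, if_neg hm]
    congr 1 <;> ring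

theorem hex_injective (hk : 3 ≤ k) (hq : Even q) (a b : ℤ) :
    Function.Injective (hex k q a b) := by
  intro r t h
  have hX : ∀ r t : Fin 6, -2 ≤ hexX r - hexX t ∧ hexX r - hexX t ≤ 2 := by decide
  have hY : ∀ r t : Fin 6, hexX r = hexX t → (hexY r - hexY t) % 2 = 0 → r = t := by decide
  obtain ⟨h1, h2⟩ := cov_inj hk hq h (by have := (hX r t).1; omega) (by have := (hX r t).2; omega)
  exact hY r t (by omega) (by omega)

theorem mem_faceBd_self (hk : 3 ≤ k) (f : Face k q) (e : Sym2 (Vert k q)) :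
    e ∈ faceBd k q f ↔ ∃ t : Fin 6, e = s(hex k q f.1.1 f.1.2 t, hex k q f.1.1 f.1.2 (t + 1)) := by
  have hf := f.2.1
  have key : ∀ x y : ℕ, x ≤ 2 →
      pt k q (f.1.1 + x, f.1.2 + y) = vert k q (f.1.1 + x) (f.1.2 + y) := by
    intro x y hx
    rw [pt_eq_vert (by omega) (by omega)]
    push_cast
    rfl
  simp only [faceBd, key _ _ (Nat.zero_le 2), key _ _ (Nat.le_refl 2), key _ _ one_le_two,
    Set.mem_insert_iff, Set.mem_singleton_iff]
  constructor
  · rintro (h | h | h | h | h | h)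
    exacts [⟨0, h⟩, ⟨1, h⟩, ⟨2, h⟩, ⟨3, h⟩, ⟨4, h⟩, ⟨5, h⟩]
  · rintro ⟨t, rfl⟩
    fin_cases t
    · exact Or.inl rfl
    · exact Or.inr (Or.inl rfl)
    · exact Or.inr (Or.inr (Or.inl rfl))
    · exact Or.inr (Or.inr (Or.inr (Or.inl rfl)))
    · exact Or.inr (Or.inr (Or.inr (Or.inr (Or.inl rfl))))
    · exact Or.inr (Or.inr (Or.inr (Or.inr (Or.inr rfl))))

/-- Reversing the corners sends edge `t` to edge `4 - t`, whose number has the same parity. Thus the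
marking by even edges does not depend on the chosen lift of a face. Taking `p` trivial covers the
whole boundary as well. -/
theorem hex_edges_rev {V : Type*} (x : Fin 6 → V) (p : ℕ → Prop)
    (hp : ∀ t : Fin 6, p (4 - t).val ↔ p t.val) (e : Sym2 V) :
    (∃ t : Fin 6, p t.val ∧ e = s(x (5 - t), x (5 - (t + 1)))) ↔
      ∃ t : Fin 6, p t.val ∧ e = s(x t, x (t + 1)) := by
  have h1 : ∀ t : Fin 6, 5 - t = (4 - t) + 1 ∧ 5 - (t + 1) = 4 - t ∧ 4 - (4 - t) = t := by decide
  constructor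
  · rintro ⟨t, ht, rfl⟩
    exact ⟨4 - t, (hp t).2 ht, by rw [(h1 t).1, (h1 t).2.1, Sym2.eq_swap]⟩
  · rintro ⟨t, ht, rfl⟩
    refine ⟨4 - t, (hp t).2 ht, ?_⟩
    rw [(h1 (4 - t)).1, (h1 (4 - t)).2.1, (h1 t).2.2, Sym2.eq_swap]

theorem mem_hex_edges_of_rep (hk : k ≠ 0) {f : Face k q} {a b : ℤ} (h : Rep k q f a b)
    (p : ℕ → Prop) (hp : ∀ t : Fin 6, p (4 - t).val ↔ p t.val) (e : Sym2 (Vert k q)) :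
    (∃ t : Fin 6, p t.val ∧ e = s(hex k q f.1.1 f.1.2 t, hex k q f.1.1 f.1.2 (t + 1))) ↔
      ∃ t : Fin 6, p t.val ∧ e = s(hex k q a b t, hex k q a b (t + 1)) := by
  obtain ⟨m, t, rfl, rfl⟩ := exists_deck_of_cov_eq hk h.2
  simp only [hex_deck hk]
  split_ifs
  · rfl
  · exact (hex_edges_rev _ p hp e).symm

theorem mem_faceBd_iff (hk : 3 ≤ k) {f : Face k q} {a b : ℤ} (h : Rep k q f a b)
    (e : Sym2 (Vert k q)) :
    e ∈ faceBd k q f ↔ ∃ t : Fin 6, e = s(hex k q a b t, hex k q a b (t + 1)) := by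
  rw [mem_faceBd_self hk]
  simpa using mem_hex_edges_of_rep (by omega) h (fun _ => True) (by simp) e

theorem mem_evenBd_iff (hk : 3 ≤ k) {f : Face k q} {a b : ℤ} (h : Rep k q f a b)
    (e : Sym2 (Vert k q)) : e ∈ evenBd k q f ↔
      ∃ t : Fin 6, t.val % 2 = 0 ∧ e = s(hex k q a b t, hex k q a b (t + 1)) :=
  mem_hex_edges_of_rep (by omega) h (fun n => n % 2 = 0) (by decide) e

/-- A face at the vertex `(i, j)` comes from a hexagon of the plane lattice with the corner
`(i, j)`. -/
theorem exists_rep_of_touches (hk : 3 ≤ k) (hq : Even q) {i j : ℤ} {f : Face k q}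
    (h : Touches (faceBd k q) (vert k q i j) f) :
    ∃ (a b : ℤ) (r : Fin 6), Rep k q f a b ∧ i = a + hexX r ∧ j = b + hexY r := by
  have hk0 : k ≠ 0 := by omega
  obtain ⟨e, he, hv⟩ := h
  rw [mem_faceBd_self hk] at he
  obtain ⟨t, rfl⟩ := he
  have : ∃ r, hex k q f.1.1 f.1.2 r = vert k q i j := by
    rcases Sym2.mem_iff.1 hv with h | h <;> exact ⟨_, h.symm⟩
  obtain ⟨r, hr⟩ := this
  obtain ⟨m, t, rfl, rfl⟩ := exists_deck_of_cov_eq hk0 hr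
  refine ⟨f.1.1 + m * k, deck q (shift k - 1) m t f.1.2, if Even m then r else 5 - r,
    rep_deck hk0 hq (rep_self f) m t, ?_, ?_⟩
  · split_ifs
    · ring
    · rw [(hex_rev r).1]
      ring
  · simp only [deck]
    split_ifs
    · ring
    · rw [(hex_rev r).2]
      ring

end Lattice

end Ko

/-! ### The polyhex as an alternating map -/

namespace Ko

open SurfaceMap

section Graph

variable {k q : ℕ}

theorem vert_deck (hk : k ≠ 0) (m t i j : ℤ) :
    vert k q (i + m * k) (deck q (shift k) m t j) = vert k q i j := cov_deck hk _ _ _ _ _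

theorem exists_vert (hk : k ≠ 0) (hq : q ≠ 0) (v : Vert k q) : ∃ i j : ℤ, v = vert k q i j := by
  have : NeZero k := ⟨hk⟩
  have : NeZero q := ⟨hq⟩
  refine ⟨v.1.val, v.2.val, ?_⟩
  have h0 : (v.1.val : ℤ) / k = 0 :=
    Int.ediv_eq_zero_of_lt (by omega) (by exact_mod_cast ZMod.val_lt v.1)
  rw [vert, cov, h0]
  simp

theorem adj_right (hk : 3 ≤ k) (hq : Even q) (hq0 : q ≠ 0) (i j : ℤ) :
    (graph k q).Adj (vert k q i j) (vert k q (i + 1) j) := by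
  rw [graph, SimpleGraph.fromRel_adj]
  refine ⟨fun h => ?_, Or.inl ?_⟩
  · have := (cov_inj hk hq h (by omega) (by omega)).1
    omega
  · have hk0 : k ≠ 0 := by omega
    obtain ⟨m, t, a, b, ha, hb, h1, h2⟩ := exists_fundamental hk0 hq0 (shift k) i j
    refine ⟨(a, b), (a + 1, b), Or.inl ⟨by simp only; omega, by simp only; omega, rfl⟩, ?_, ?_⟩
    · rw [pt_eq_vert hk0 (by omega), ← vert_deck hk0 m t i, h1, h2]
    · rw [pt_eq_vert hk0 (by omega), ← vert_deck hk0 m t (i + 1), h2, add_right_comm, h1]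
      push_cast
      rfl

theorem adj_up (hk : 3 ≤ k) (hq : Even q) (hq0 : q ≠ 0) {i j : ℤ} (hij : Even (i + j)) :
    (graph k q).Adj (vert k q i j) (vert k q i (j + 1)) := by
  rw [graph, SimpleGraph.fromRel_adj]
  refine ⟨fun h => ?_, ?_⟩
  · have := (cov_inj hk hq h (by omega) (by omega)).2
    omega
  · have hk0 : k ≠ 0 := by omega
    -- With `shift k - 1` the point `(a, b)` is again the lower end of a vertical edge. For odd `m`
    -- that edge is the given one upside down, whence the two cases below.
    obtain ⟨m, t, a, b, ha, hb, h1, h2⟩ := exists_fundamental hk0 hq0 (shift k - 1) i j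
    have hpar : Even ((a : ℤ) + b) := by
      rw [← h1, ← h2, even_deck_iff hq _ _ _ _ _ (even_shift_sub_one k)]
      exact hij
    rw [Int.even_iff] at hpar
    have hL : LatticeEdge k q (a, b) (a, b + 1) :=
      Or.inr ⟨by simp only; omega, by simp only; omega, by simp only; omega, rfl⟩
    have e1 := pt_eq_vert (q := q) hk0 (b := b) (show a < 2 * k by omega)
    have e2 := pt_eq_vert (q := q) hk0 (b := b + 1) (show a < 2 * k by omega)
    have hh := vert_deck (q := q) hk0 m t i
    by_cases hm : Even m
    · simp only [deck, if_pos hm] at h2 hh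
      refine Or.inl ⟨_, _, hL, ?_, ?_⟩
      · rw [e1, ← hh, h1, h2]
      · rw [e2, ← hh, h1, add_right_comm, h2]
        push_cast
        rfl
    · simp only [deck, if_neg hm] at h2 hh
      refine Or.inr ⟨_, _, hL, ?_, ?_⟩
      · rw [e1, ← hh, h1, ← h2]
        congr 1
        ring
      · rw [e2, ← hh, h1]
        congr 1
        push_cast
        rw [← h2]
        ring

theorem exists_lift_of_latticeEdge (hk : 3 ≤ k) {p r : ℕ × ℕ} (h : LatticeEdge k q p r) :
    ∃ i j : ℤ, pt k q p = vert k q i j ∧ (pt k q r = vert k q (i + 1) j ∨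
      Even (i + j) ∧ pt k q r = vert k q i (j + 1)) := by
  obtain ⟨a, b⟩ := p
  refine ⟨a, b, ?_⟩
  rcases h with ⟨h1, h2, rfl⟩ | ⟨h1, h2, h3, rfl⟩
  · simp only at h1 h2
    rw [pt_eq_vert (by omega) (by omega), pt_eq_vert (by omega) (by omega)]
    refine ⟨rfl, Or.inl ?_⟩
    push_cast
    rfl
  · simp only at h1 h2 h3
    rw [pt_eq_vert (by omega) (by omega), pt_eq_vert (by omega) (by omega)]
    refine ⟨rfl, Or.inr ⟨?_, ?_⟩⟩
    · rw [Int.even_iff]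
      omega
    · push_cast
      rfl

theorem neighbour_cases (hk : 3 ≤ k) (hq : Even q) {i j : ℤ} {u : Vert k q}
    (h : (graph k q).Adj (vert k q i j) u) : u = vert k q (i - 1) j ∨ u = vert k q (i + 1) j ∨
      (Even (i + j) ∧ u = vert k q i (j + 1)) ∨ (¬ Even (i + j) ∧ u = vert k q i (j - 1)) := by
  have hk0 : k ≠ 0 := by omega
  have hsh := even_shift k
  rw [graph, SimpleGraph.fromRel_adj] at h
  obtain ⟨-, ⟨p, r, hL, hp, hr⟩ | ⟨p, r, hL, hp, hr⟩⟩ := h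
  · obtain ⟨i', j', h1, h2⟩ := exists_lift_of_latticeEdge hk hL
    rw [hp] at h1
    rw [hr] at h2
    obtain ⟨m, t, rfl, rfl⟩ := exists_deck_of_cov_eq hk0 h1.symm
    rcases h2 with rfl | ⟨hpar, rfl⟩
    · refine Or.inr (Or.inl ?_)
      rw [add_right_comm, vert_deck hk0]
    · refine Or.inr (Or.inr ?_)
      rw [even_deck_iff' hq _ _ _ _ _ hsh, ← vert_deck hk0 m t i' (j' + 1)]
      by_cases hm : Even m
      · refine Or.inl ⟨by tauto, ?_⟩
        simp only [deck, if_pos hm]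
        congr 1
        ring
      · refine Or.inr ⟨by tauto, ?_⟩
        simp only [deck, if_neg hm]
        congr 1
        ring
  · obtain ⟨i', j', h1, h2⟩ := exists_lift_of_latticeEdge hk hL
    rw [hp] at h1
    rw [hr] at h2
    subst h1
    rcases h2 with h2 | ⟨hpar, h2⟩
    · obtain ⟨m, t, rfl, rfl⟩ := exists_deck_of_cov_eq hk0 h2.symm
      refine Or.inl ?_
      rw [show i' + 1 + m * k - 1 = i' + m * k by ring, vert_deck hk0]
    · obtain ⟨m, t, rfl, rfl⟩ := exists_deck_of_cov_eq hk0 h2.symm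
      refine Or.inr (Or.inr ?_)
      have hpar' : ¬ Even (i' + (j' + 1)) := by
        rw [Int.even_iff] at hpar ⊢
        omega
      rw [even_deck_iff' hq _ _ _ _ _ hsh, ← vert_deck hk0 m t i' j']
      by_cases hm : Even m
      · refine Or.inr ⟨by tauto, ?_⟩
        simp only [deck, if_pos hm]
        congr 1
        ring
      · refine Or.inl ⟨by tauto, ?_⟩
        simp only [deck, if_neg hm]
        congr 1
        ring

theorem faceBd_subset (hk : 3 ≤ k) (hq : Even q) (hq0 : q ≠ 0) (f : Face k q) :
    faceBd k q f ⊆ (graph k q).edgeSet := by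
  intro e he
  rw [mem_faceBd_self hk] at he
  obtain ⟨t, rfl⟩ := he
  have hpar := (rep_self f).1
  generalize (f.1.1 : ℤ) = a at *
  generalize (f.1.2 : ℤ) = b at *
  rw [SimpleGraph.mem_edgeSet]
  have hR := adj_right hk hq hq0
  have h2 : Even (a + 2 + b) := by
    rw [Int.even_iff] at hpar ⊢
    omega
  fin_cases t
  · simpa [hex, hexX, hexY] using hR a b
  · simpa [hex, hexX, hexY, add_assoc] using hR (a + 1) b
  · simpa [hex, hexX, hexY] using adj_up hk hq hq0 h2
  · simpa [hex, hexX, hexY, add_assoc] using (hR (a + 1) (b + 1)).symm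
  · simpa [hex, hexX, hexY] using (hR a (b + 1)).symm
  · simpa [hex, hexX, hexY] using (adj_up hk hq hq0 hpar).symm

theorem vert_ne (hk : 3 ≤ k) (hq : Even q) {i j i' j' : ℤ} (h1 : -2 ≤ i - i') (h2 : i - i' ≤ 2)
    (h : i ≠ i' ∨ (j - j') % 2 ≠ 0) : vert k q i j ≠ vert k q i' j' := by
  intro he
  have := cov_inj hk hq he h1 h2
  tauto

theorem three_injective {V : Type*} {a b c : V} (hab : a ≠ b) (hac : a ≠ c) (hbc : b ≠ c) :
    Function.Injective ![a, b, c] := by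
  intro x y h
  fin_cases x <;> fin_cases y <;> simp_all

theorem alternatingAt_even (hk : 3 ≤ k) (hq : Even q) (hq0 : q ≠ 0) {i j : ℤ}
    (hij : Even (i + j)) : ∃ nb fc,
      AlternatingAt (graph k q) (faceBd k q) (evenBd k q) (vert k q i j) nb fc := by
  have hk0 : k ≠ 0 := by omega
  have hpar := hij
  rw [Int.even_iff] at hpar
  obtain ⟨f₀, h₀⟩ := exists_rep hk0 hq hq0 hij
  obtain ⟨f₁, h₁⟩ := exists_rep (a := i - 2) (b := j) hk0 hq hq0 (by rw [Int.even_iff]; omega)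
  obtain ⟨f₂, h₂⟩ := exists_rep (a := i - 1) (b := j - 1) hk0 hq hq0 (by rw [Int.even_iff]; omega)
  -- The point `(i, j)` is corner 0, 2, 4, respectively, of the three hexagons with these lower left
  -- corners, listed so that the `m`-th one avoids the edge to the `m`-th neighbour.
  let a : Fin 3 → ℤ := ![i, i - 2, i - 1]
  let b : Fin 3 → ℤ := ![j, j, j - 1]
  have hrep : ∀ m, Rep k q (![f₀, f₁, f₂] m) (a m) (b m) := by
    intro m
    fin_cases m
    exacts [h₀, h₁, h₂]
  refine ⟨![vert k q (i - 1) j, vert k q (i + 1) j, vert k q i (j + 1)], ![f₀, f₁, f₂],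
    alternatingAt_of_hexagons ?_ ?_ ?_ (fun m => hex k q (a m) (b m))
      (fun m => hex_injective hk hq _ _) (fun m e => mem_faceBd_iff hk (hrep m) e)
      (fun m e => mem_evenBd_iff hk (hrep m) e) ![0, 2, 4] ?_ ?_ ?_⟩
  · exact three_injective (vert_ne hk hq (by omega) (by omega) (by omega))
      (vert_ne hk hq (by omega) (by omega) (by omega))
      (vert_ne hk hq (by omega) (by omega) (by omega))
  · intro u
    constructor
    · intro hu
      rcases neighbour_cases hk hq hu with h | h | ⟨-, h⟩ | ⟨h, -⟩
      exacts [⟨0, h⟩, ⟨1, h⟩, ⟨2, h⟩, absurd hij h]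
    · rintro ⟨l, rfl⟩
      fin_cases l
      · simpa using (adj_right hk hq hq0 (i - 1) j).symm
      · exact adj_right hk hq hq0 i j
      · exact adj_up hk hq hq0 hij
  · intro f hf
    obtain ⟨a', b', r, hr, hi, hj⟩ := exists_rep_of_touches hk hq hf
    have hp := hr.1
    rw [Int.even_iff] at hp
    have hab : (a' = i ∧ b' = j) ∨ (a' = i - 2 ∧ b' = j) ∨ (a' = i - 1 ∧ b' = j - 1) := by
      fin_cases r <;> simp [hexX, hexY] at hi hj <;> omega
    rcases hab with ⟨rfl, rfl⟩ | ⟨rfl, rfl⟩ | ⟨rfl, rfl⟩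
    exacts [⟨0, rep_unique hr h₀⟩, ⟨1, rep_unique hr h₁⟩, ⟨2, rep_unique hr h₂⟩]
  · intro m
    fin_cases m <;> simp [hex, hexX, hexY, a, b]
  · intro m
    fin_cases m
    · simp [hex, hexX, hexY, a, b, evenNbr]
    · simp [hex, hexX, hexY, a, b, evenNbr]
    · simp [hex, hexX, hexY, a, b, evenNbr]
  · intro m
    fin_cases m
    · simp [hex, hexX, hexY, a, b, oddNbr]
    · simp [hex, hexX, hexY, a, b, oddNbr]
      congr 1; ring
    · simp [hex, hexX, hexY, a, b, oddNbr]
      congr 1; ring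

/-- The mirror image of the even case in a horizontal line: the corners 0, 2, 4 become 5, 3, 1. -/
theorem alternatingAt_odd (hk : 3 ≤ k) (hq : Even q) (hq0 : q ≠ 0) {i j : ℤ}
    (hij : ¬ Even (i + j)) : ∃ nb fc,
      AlternatingAt (graph k q) (faceBd k q) (evenBd k q) (vert k q i j) nb fc := by
  have hk0 : k ≠ 0 := by omega
  have hpar := hij
  rw [Int.even_iff] at hpar
  obtain ⟨f₀, h₀⟩ := exists_rep (a := i) (b := j - 1) hk0 hq hq0 (by rw [Int.even_iff]; omega)
  obtain ⟨f₁, h₁⟩ := exists_rep (a := i - 2) (b := j - 1) hk0 hq hq0 (by rw [Int.even_iff]; omega)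
  obtain ⟨f₂, h₂⟩ := exists_rep (a := i - 1) (b := j) hk0 hq hq0 (by rw [Int.even_iff]; omega)
  let a : Fin 3 → ℤ := ![i, i - 2, i - 1]
  let b : Fin 3 → ℤ := ![j - 1, j - 1, j]
  have hrep : ∀ m, Rep k q (![f₀, f₁, f₂] m) (a m) (b m) := by
    intro m
    fin_cases m
    exacts [h₀, h₁, h₂]
  refine ⟨![vert k q (i - 1) j, vert k q (i + 1) j, vert k q i (j - 1)], ![f₀, f₁, f₂],
    alternatingAt_of_hexagons ?_ ?_ ?_ (fun m => hex k q (a m) (b m))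
      (fun m => hex_injective hk hq _ _) (fun m e => mem_faceBd_iff hk (hrep m) e)
      (fun m e => mem_evenBd_iff hk (hrep m) e) ![5, 3, 1] ?_ ?_ ?_⟩
  · exact three_injective (vert_ne hk hq (by omega) (by omega) (by omega))
      (vert_ne hk hq (by omega) (by omega) (by omega))
      (vert_ne hk hq (by omega) (by omega) (by omega))
  · intro u
    constructor
    · intro hu
      rcases neighbour_cases hk hq hu with h | h | ⟨h, -⟩ | ⟨-, h⟩
      exacts [⟨0, h⟩, ⟨1, h⟩, absurd h hij, ⟨2, h⟩]
    · rintro ⟨l, rfl⟩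
      fin_cases l
      · simpa using (adj_right hk hq hq0 (i - 1) j).symm
      · exact adj_right hk hq hq0 i j
      · have hd : Even (i + (j - 1)) := by
          rw [Int.even_iff]
          omega
        simpa using (adj_up hk hq hq0 hd).symm
  · intro f hf
    obtain ⟨a', b', r, hr, hi, hj⟩ := exists_rep_of_touches hk hq hf
    have hp := hr.1
    rw [Int.even_iff] at hp
    have hab : (a' = i ∧ b' = j - 1) ∨ (a' = i - 2 ∧ b' = j - 1) ∨ (a' = i - 1 ∧ b' = j) := by
      fin_cases r <;> simp [hexX, hexY] at hi hj <;> omega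
    rcases hab with ⟨rfl, rfl⟩ | ⟨rfl, rfl⟩ | ⟨rfl, rfl⟩
    exacts [⟨0, rep_unique hr h₀⟩, ⟨1, rep_unique hr h₁⟩, ⟨2, rep_unique hr h₂⟩]
  · intro m
    fin_cases m <;> simp [hex, hexX, hexY, a, b]
  · intro m
    fin_cases m
    · simp [hex, hexX, hexY, a, b, evenNbr]
    · simp [hex, hexX, hexY, a, b, evenNbr]
    · simp [hex, hexX, hexY, a, b, evenNbr]
  · intro m
    fin_cases m
    · simp [hex, hexX, hexY, a, b, oddNbr]
    · simp [hex, hexX, hexY, a, b, oddNbr]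
      congr 1; ring
    · simp [hex, hexX, hexY, a, b, oddNbr]
      congr 1; ring

theorem isAlternating (hk : 3 ≤ k) (hq : Even q) (hq0 : q ≠ 0) :
    IsAlternating (graph k q) (faceBd k q) (evenBd k q) := by
  refine ⟨faceBd_subset hk hq hq0, fun v => ?_⟩
  obtain ⟨i, j, rfl⟩ := exists_vert (by omega) hq0 v
  by_cases hij : Even (i + j)
  · exact alternatingAt_even hk hq hq0 hij
  · exact alternatingAt_odd hk hq hq0 hij

theorem graph_connected (hk : 3 ≤ k) (hq : Even q) (hq0 : q ≠ 0) : (graph k q).Connected := by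
  have hR : ∀ i j, (graph k q).Reachable (vert k q i j) (vert k q (i + 1) j) := fun i j =>
    (adj_right hk hq hq0 i j).reachable
  have hU : ∀ i j, (graph k q).Reachable (vert k q i j) (vert k q i (j + 1)) := by
    intro i j
    by_cases hij : Even (i + j)
    · exact (adj_up hk hq hq0 hij).reachable
    · have h1 : Even (i + 1 + j) := by
        rw [Int.even_iff] at hij ⊢
        omega
      exact (hR i j).trans ((adj_up hk hq hq0 h1).reachable.trans (hR i (j + 1)).symm)
  have hrow : ∀ i j, (graph k q).Reachable (vert k q 0 j) (vert k q i j) := by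
    intro i j
    induction i using Int.induction_on with
    | zero => rfl
    | succ n ih => exact ih.trans (hR _ _)
    | pred n ih =>
      refine ih.trans ?_
      simpa using (hR (-(n : ℤ) - 1) j).symm
  have hcol : ∀ j, (graph k q).Reachable (vert k q 0 0) (vert k q 0 j) := by
    intro j
    induction j using Int.induction_on with
    | zero => rfl
    | succ n ih => exact ih.trans (hU _ _)
    | pred n ih =>
      refine ih.trans ?_
      simpa using (hU 0 (-(n : ℤ) - 1)).symm
  have hall : ∀ v, (graph k q).Reachable (vert k q 0 0) v := by
    intro v
    obtain ⟨i, j, rfl⟩ := exists_vert (by omega) hq0 v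
    exact (hcol j).trans (hrow i j)
  have : Nonempty (Vert k q) := ⟨vert k q 0 0⟩
  exact SimpleGraph.Connected.mk fun u v => (hall u).symm.trans (hall v)

/-! ### Non-orientability and the Euler characteristic -/

/-- The row at height `-1` gives an odd closed walk. For odd `k` this height is fixed by `j ↦ -2 -
j`, so the row closes up after `k` steps. For even `k` the row leads in `k` steps from `(0, -1)` to
`(0, 0)`, and three more edges lead back. -/
theorem not_two_colorable (hk : 3 ≤ k) (hq : Even q) (hq0 : q ≠ 0) :
    ¬ ∃ η : Vert k q → ZMod 2, ∀ v u, (graph k q).Adj v u → η u = η v + 1 := by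
  rintro ⟨η, hη⟩
  have hk0 : k ≠ 0 := by omega
  have hrow : ∀ (n : ℕ) j, η (vert k q n j) = η (vert k q 0 j) + n := by
    intro n j
    induction n with
    | zero => simp
    | succ n ih =>
      have := hη _ _ (adj_right hk hq hq0 n j)
      push_cast
      rw [this, ih]
      ring
  have hglue : ∀ j, vert k q k j = vert k q 0 (shift k - j) := by
    intro j
    have := vert_deck (q := q) hk0 1 0 0 (shift k - j)
    simpa [deck] using this
  have hone := hrow k (-1)
  rw [hglue] at hone
  by_cases hke : Even k
  · -- from `(k, -1)` to `(0, -1)`, by way of `(1, 0)`, `(1, -1)`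
    have e0 : vert k q 0 (shift k - -1) = vert k q 0 0 := by simp [shift, hke]
    have e1 := hη _ _ (adj_right hk hq hq0 0 0)
    have e2 := hη _ _ (adj_up (i := 0 + 1) (j := -1) hk hq hq0 (by decide))
    have e3 := hη _ _ (adj_right hk hq hq0 0 (-1))
    rw [e0, (ZMod.natCast_eq_zero_iff_even).2 hke] at hone
    rw [show (-1 : ℤ) + 1 = 0 by norm_num, e1, e3, hone] at e2
    revert e2
    generalize η (vert k q 0 (-1)) = x
    decide +revert
  · have e0 : vert k q 0 (shift k - -1) = vert k q 0 (-1) := by simp [shift, hke]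
    rw [e0, (ZMod.natCast_eq_one_iff_odd).2 (Nat.not_even_iff_odd.1 hke)] at hone
    simp at hone

theorem two_mul_card_face (hq : Even q) : 2 * Nat.card (Face k q) = k * q := by
  obtain ⟨p, rfl⟩ := hq
  let e : Face k (p + p) ≃ Fin k × Fin p :=
    { toFun := fun f => (⟨f.1.1, f.2.1⟩, ⟨f.1.2 / 2, by have := f.2.2.1; omega⟩)
      invFun := fun x => ⟨(x.1.1, 2 * x.2.1 + x.1.1 % 2), x.1.2,
        by have := x.2.2; simp only; omega, by simp only; omega⟩
      left_inv := by
        rintro ⟨⟨a, b⟩, h1, h2, h3⟩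
        simp only at h3
        simp only [Subtype.mk.injEq, Prod.mk.injEq, true_and]
        omega
      right_inv := by
        rintro ⟨⟨a, ha⟩, ⟨b, hb⟩⟩
        simp only [Prod.mk.injEq, Fin.mk.injEq, true_and]
        omega }
  rw [Nat.card_congr e]
  simp
  ring

theorem isKleinBottleEmbedding (hk : 3 ≤ k) (hq : Even q) (hq0 : q ≠ 0) :
    IsKleinBottleEmbedding (graph k q) (faceBd k q) := by
  have hA := isAlternating hk hq hq0
  have : NeZero k := ⟨by omega⟩
  have : NeZero q := ⟨hq0⟩
  have hF := two_mul_card_face (k := k) hq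
  refine ⟨⟨inferInstance, ?_, graph_connected hk hq hq0, fun f => ?_, hA.ncard_faces,
    hA.link_connected⟩, fun ho => not_two_colorable hk hq hq0 (hA.exists_two_coloring ho), ?_⟩
  · refine Nat.finite_of_card_ne_zero fun h0 => ?_
    rw [h0] at hF
    have : 0 < k * q := Nat.mul_pos (by omega) (by omega)
    omega
  · exact exists_bounds_of_hexagon (hex_injective hk hq _ _) (faceBd_subset hk hq hq0 f)
      (mem_faceBd_self hk f)
  · have hE := hA.two_mul_card_edgeSet
    have hV : Nat.card (Vert k q) = k * q := by simp
    rw [hV] at hE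
    rw [eulerChar, hV]
    omega

end Graph

end Ko

theorem lemma4p9 (k q : ℕ) (hk : 3 ≤ k) (hq : Even q) (hq0 : 0 < q) :
    SurfaceMap.IsCrossCapOdd (Ko.graph k q) (Ko.faceBd k q) :=
  ⟨Ko.isKleinBottleEmbedding hk hq hq0.ne', fun _ _ hw _ =>
    (Ko.isAlternating hk hq hq0.ne').odd_length_iff_oneSided hw⟩
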